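/- **Proposition 4.3 (Constructing a nilpotent translational system).** "Locally compact group" and "compact group" mean Hausdorff and second countable. Let $\Gamma$ be an (at most) countable abelian group, let $Z$ be a compact metrizable abelian group with Haar probability measure $\mu$, and let $\phi_Z\colon\Gamma\to Z$ be a homomorphism such that the rotational $\Gamma$-system $S^\gamma z=\phi_Z(\gamma)+z$ on $(Z,\mu)$ is ergodic. Let $K$ be a compact abelian Lie group with Haar probability measure $\kappa$. Let $\rho=(\rho_\gamma)_{\gamma\in\Gamma}$ be a $(Z,K)$-cocycle, that is, a family of measurable maps $\rho_\gamma\colon Z\to K$ (defined up to almost everywhere equality) with $\rho_{\gamma_1+\gamma_2}=\rho_{\gamma_1}\circ S^{\gamma_2}+\rho_{\gamma_2}$ $\mu$-almost everywhere for all $\gamma_1,\gamma_2\in\Gamma$. Let $Z\rtimes_\rho K$ be the abstract $\Gamma$-system defined by the maps $T^\gamma(z,k)=(S^\gamma z,\,k+\rho_\gamma(z))$, which act up to null sets on $(Z\times K,\mu\times\kappa)$. Assume that $\rho$ is ergodic, i.e. that $Z\rtimes_\rho K$ is ergodic, and that $\rho$ obeys the Conze–Lesigne equation: for every $z\in Z$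 there are a measurable $F_z\colon Z\to K$ and a homomorphism $c_z\colon\Gamma\to K$ such that $$\rho_\gamma(z+z')-\rho_\gamma(z')=F_z(S^\gamma z')-F_z(z')+c_z(\gamma)$$ for all $\gamma\in\Gamma$ and $\mu$-almost every $z'\in Z$. Then $Z\rtimes_\rho K$ is abstractly isomorphic to a good system, i.e. to a translational $\Gamma$-system $G/\Lambda$ (with $G$ a locally compact unimodular group, $\Lambda$ a closed cocompact subgroup, the $G$-invariant Borel probability measure on $G/\Lambda$, and the action $T^\gamma x=\phi(\gamma)x$ for some homomorphism $\phi\colon\Gamma\to G$) such that $G$ is a Polish group that is nilpotent of class at most two, $\Lambda$ is an abelian lattice (a discrete cocompact subgroup) in $G$, and $G$ has a compact central Lie subgroup $G_2$ with $[G,G]\subset G_2$ and $\Lambda\cap G_2$ trivial. Here two systems are abstractly isomorphic if there is a measure-preserving isomorphism between their probability algebras (measurable sets modulo null sets) that intertwines the actions of $\Gamma$, and a system is ergodic if every $\Gamma$-invariant element of its probability algebra is $0$ or $1$. -/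

import Mathlib

open MeasureTheory
open scoped ContDiff Manifold

universe u v w

namespace CLSystem

section ProbabilityAlgebra

variable {X : Type*} {Y : Type*} [MeasurableSpace X] [MeasurableSpace Y]

/-- Two measurable sets are identified when their symmetric difference is null. -/
def setoidModNull (μ : Measure X) : Setoid {s : Set X // MeasurableSet s} where
  r s t := (s : Set X) =ᵐ[μ] (t : Set X)
  iseqv := ⟨fun _ => Filter.EventuallyEq.rfl, fun h => h.symm, fun h k => h.trans k⟩

/-- The probability algebra of `(X, μ)`: measurable sets modulo null sets. -/
def ProbAlg (μ : Measure X) : Type _ := Quotient (setoidModNull μ)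

namespace ProbAlg

variable {μ : Measure X} {ν : Measure Y}

/-- The class of a measurable set. -/
def mk (μ : Measure X) (s : Set X) (hs : MeasurableSet s) : ProbAlg μ :=
  Quotient.mk (setoidModNull μ) ⟨s, hs⟩

/-- The measure of a class. -/
noncomputable def measure (E : ProbAlg μ) : ENNReal :=
  Quotient.lift (fun s : {s : Set X // MeasurableSet s} => μ s)
    (fun _ _ h => measure_congr h) E

/-- The Boolean order: `[s] ≤ [t]` when `s` is contained in `t` up to a null set. -/
instance : PartialOrder (ProbAlg μ) where
  le E F := Quotient.liftOn₂ E F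
    (fun s t : {s : Set X // MeasurableSet s} => (s : Set X) ≤ᵐ[μ] (t : Set X))
    (fun _ _ _ _ h k => propext
      ⟨fun l => h.symm.le.trans (l.trans k.le), fun l => h.le.trans (l.trans k.symm.le)⟩)
  le_refl E := by
    induction E using Quotient.inductionOn with | _ s => exact Filter.EventuallyLE.refl _ _
  le_trans E F H := by
    induction E using Quotient.inductionOn with | _ s
    induction F using Quotient.inductionOn with | _ t
    induction H using Quotient.inductionOn with | _ r
    exact fun h k => Filter.EventuallyLE.trans h k
  le_antisymm E F := by
    induction E using Quotient.inductionOn with | _ s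
    induction F using Quotient.inductionOn with | _ t
    exact fun h k => Quotient.sound (Filter.EventuallyLE.antisymm h k)

/-- The pullback `[s] ↦ [f⁻¹ s]` along a measure-preserving map. -/
def comap (f : X → Y) (hf : MeasurePreserving f μ ν) (E : ProbAlg ν) : ProbAlg μ :=
  Quotient.map (fun s : {s : Set Y // MeasurableSet s} =>
      (⟨f ⁻¹' s, hf.measurable s.2⟩ : {s : Set X // MeasurableSet s}))
    (fun _ _ h => hf.quasiMeasurePreserving.preimage_ae_eq h) E

end ProbAlg

end ProbabilityAlgebra

section Systems

variable {Γ : Type*} [AddCommGroup Γ] {X : Type*} {Y : Type*}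
  [MeasurableSpace X] [MeasurableSpace Y] {μ : Measure X} {ν : Measure Y}

/-- A near-action of `Γ` on `(X, μ)`: measure-preserving maps that satisfy the action laws almost
everywhere.  Genuine measure-preserving actions are the special case where they hold everywhere. -/
structure NearAction (Γ : Type*) [AddCommGroup Γ] {X : Type*} [MeasurableSpace X]
    (μ : Measure X) where
  act : Γ → X → X
  measurePreserving : ∀ γ, MeasurePreserving (act γ) μ μ
  act_zero : ∀ᵐ x ∂μ, act 0 x = x
  act_add : ∀ γ₁ γ₂, ∀ᵐ x ∂μ, act (γ₁ + γ₂) x = act γ₁ (act γ₂ x)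

/-- The action on the probability algebra by pullback, `[s] ↦ [(T^γ)⁻¹ s]`; it is all that the
abstract `Γ`-system defined by a near-action retains. -/
def NearAction.pullback (T : NearAction Γ μ) (γ : Γ) : ProbAlg μ → ProbAlg μ :=
  ProbAlg.comap (T.act γ) (T.measurePreserving γ)

/-- Ergodicity: the algebra of invariant classes is trivial. -/
def NearAction.IsErgodic (T : NearAction Γ μ) : Prop :=
  ∀ E : ProbAlg μ, (∀ γ, T.pullback γ E = E) →
    E = ProbAlg.mk μ ∅ MeasurableSet.empty ∨ E = ProbAlg.mk μ Set.univ MeasurableSet.univ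

/-- An abstract isomorphism `π` from the system `T` to the system `S`, given by its pullback map
`π^*`: a measure-preserving isomorphism of the probability algebras that intertwines the actions.
(Isomorphisms of Boolean algebras are the same thing as order isomorphisms; they preserve all
existing joins.) -/
structure AbstractIso (T : NearAction Γ μ) (S : NearAction Γ ν) where
  pullback : ProbAlg ν ≃o ProbAlg μ
  measure_pullback : ∀ E, (pullback E).measure = E.measure
  equivariant : ∀ γ E, pullback (S.pullback γ E) = T.pullback γ (pullback E)

/-- Two systems are abstractly isomorphic. -/
def AbstractlyIsomorphic (T : NearAction Γ μ) (S : NearAction Γ ν) : Prop :=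
  Nonempty (AbstractIso T S)

end Systems

section Cocycles

variable {Γ : Type*} [AddCommGroup Γ]

/-- The rotational system on `Z` given by a homomorphism `φ : Γ → Z`, with `T^γ z = φ(γ) + z`. -/
def rotationSystem {Z : Type*} [AddCommGroup Z] [MeasurableSpace Z] [MeasurableAdd Z]
    (μ : Measure Z) [μ.IsAddLeftInvariant] (φ : Γ →+ Z) : NearAction Γ μ where
  act γ z := φ γ + z
  measurePreserving γ := measurePreserving_add_left μ (φ γ)
  act_zero := by simp
  act_add γ₁ γ₂ := by simp [add_assoc]

variable {Y : Type*} [MeasurableSpace Y] {ν : Measure Y}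

/-- A cocycle with values in `K`; only the almost everywhere classes of the maps `ρ_γ` matter. -/
structure Cocycle (S : NearAction Γ ν) (K : Type*) [AddCommGroup K] [MeasurableSpace K] where
  toFun : Γ → Y → K
  measurable : ∀ γ, Measurable (toFun γ)
  cocycle_eq : ∀ γ₁ γ₂, ∀ᵐ y ∂ν, toFun (γ₁ + γ₂) y = toFun γ₁ (S.act γ₂ y) + toFun γ₂ y

/-- The abelian extension `Y ⋊_ρ K`, with `T^γ (y, k) = (S^γ y, k + ρ_γ(y))`, where `κ` is the
Haar probability measure of `K`. -/
def Cocycle.extension {S : NearAction Γ ν} {K : Type*} [AddCommGroup K] [MeasurableSpace K]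
    [MeasurableAdd₂ K] (ρ : Cocycle S K) (κ : Measure K) [IsProbabilityMeasure κ]
    [κ.IsAddLeftInvariant] [IsProbabilityMeasure ν] : NearAction Γ (ν.prod κ) where
  act γ p := (S.act γ p.1, p.2 + ρ.toFun γ p.1)
  measurePreserving γ := by
    refine (S.measurePreserving γ).skew_product (g := fun y k => k + ρ.toFun γ y) ?_ ?_
    · exact measurable_snd.add ((ρ.measurable γ).comp measurable_fst)
    · exact Filter.Eventually.of_forall fun y => by
        simpa [add_comm] using map_add_left_eq_self κ (ρ.toFun γ y)
  act_zero := by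
    have h1 : ∀ᵐ p ∂(ν.prod κ), S.act 0 p.1 = p.1 :=
      Measure.quasiMeasurePreserving_fst.ae S.act_zero
    have h2 : ∀ᵐ p ∂(ν.prod κ),
        ρ.toFun (0 + 0) p.1 = ρ.toFun 0 (S.act 0 p.1) + ρ.toFun 0 p.1 :=
      Measure.quasiMeasurePreserving_fst.ae (ρ.cocycle_eq 0 0)
    filter_upwards [h1, h2] with p h1 h2
    rw [h1, add_zero] at h2
    have h3 : ρ.toFun 0 p.1 = 0 := left_eq_add.mp h2
    rw [h1, h3, add_zero]
  act_add γ₁ γ₂ := by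
    have h1 : ∀ᵐ p ∂(ν.prod κ), S.act (γ₁ + γ₂) p.1 = S.act γ₁ (S.act γ₂ p.1) :=
      Measure.quasiMeasurePreserving_fst.ae (S.act_add γ₁ γ₂)
    have h2 : ∀ᵐ p ∂(ν.prod κ),
        ρ.toFun (γ₁ + γ₂) p.1 = ρ.toFun γ₁ (S.act γ₂ p.1) + ρ.toFun γ₂ p.1 :=
      Measure.quasiMeasurePreserving_fst.ae (ρ.cocycle_eq γ₁ γ₂)
    filter_upwards [h1, h2] with p h1 h2
    rw [h1, h2, add_assoc p.2, add_comm (ρ.toFun γ₂ p.1)]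

/-- The Conze--Lesigne equation: for every `z`, the derivative of `ρ` along the translation by `z`
is cohomologous to a homomorphism `Γ → K`. -/
def Cocycle.ConzeLesigne {Z : Type*} [AddCommGroup Z] [MeasurableSpace Z] [MeasurableAdd Z]
    {μ : Measure Z} [μ.IsAddLeftInvariant] {φ : Γ →+ Z} {K : Type*} [AddCommGroup K]
    [MeasurableSpace K] (ρ : Cocycle (rotationSystem μ φ) K) : Prop :=
  ∀ z : Z, ∃ F : Z → K, Measurable F ∧ ∃ c : Γ →+ K, ∀ γ, ∀ᵐ z' ∂μ,
    ρ.toFun γ (z + z') - ρ.toFun γ z' = F (φ γ + z') - F z' + c γ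

end Cocycles

/-- A topological group is a (finite-dimensional real) Lie group: it has a smooth atlas,
compatible with its topology, for which the group operations are smooth. -/
def IsRealLieGroup (G : Type*) [TopologicalSpace G] [Group G] : Prop :=
  ∃ (n : ℕ) (_ : ChartedSpace (EuclideanSpace ℝ (Fin n)) G), LieGroup (𝓡 n) ∞ G

/-- The same notion for a group that is written additively. -/
def IsRealLieAddGroup (K : Type*) [TopologicalSpace K] [AddGroup K] : Prop :=
  ∃ (n : ℕ) (_ : ChartedSpace (EuclideanSpace ℝ (Fin n)) K), LieAddGroup (𝓡 n) ∞ K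

/-- A translational `Γ`-system `G/Λ`: `G` is a locally compact Hausdorff second countable
unimodular group, `Λ` a closed cocompact subgroup, `G/Λ` carries its Borel sets and its
`G`-invariant (Haar) probability measure, and `Γ` acts through a homomorphism `φ : Γ → G`. -/
structure TranslationalSystem (Γ : Type w) [AddCommGroup Γ] where
  G : Type u
  [group : Group G]
  [topology : TopologicalSpace G]
  [isTopologicalGroup : IsTopologicalGroup G]
  [locallyCompact : LocallyCompactSpace G]
  [hausdorff : T2Space G]
  [secondCountable : SecondCountableTopology G]
  unimodular : ∀ [MeasurableSpace G] [BorelSpace G] (m : Measure G) [m.IsHaarMeasure],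
    m.IsMulRightInvariant
  Λ : Subgroup G
  isClosed : IsClosed (Λ : Set G)
  [cocompact : CompactSpace (G ⧸ Λ)]
  [measurableSpace : MeasurableSpace (G ⧸ Λ)]
  [borelSpace : BorelSpace (G ⧸ Λ)]
  μ : Measure (G ⧸ Λ)
  [isProbabilityMeasure : IsProbabilityMeasure μ]
  [invariant : SMulInvariantMeasure G (G ⧸ Λ) μ]
  φ : Multiplicative Γ →* G

namespace TranslationalSystem

attribute [instance] group topology isTopologicalGroup locallyCompact hausdorff secondCountable
  cocompact measurableSpace borelSpace isProbabilityMeasure invariant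

variable {Γ : Type w} [AddCommGroup Γ]

/-- The action `T^γ x = φ(γ) x` on `G/Λ`. -/
def system (A : TranslationalSystem.{u, w} Γ) : NearAction Γ A.μ where
  act γ x := A.φ (Multiplicative.ofAdd γ) • x
  measurePreserving γ := measurePreserving_smul _ A.μ
  act_zero := by simp
  act_add γ₁ γ₂ := by simp [mul_smul]

/-- Good systems: `G` is a Polish group, nilpotent of class at most two, `Λ` is an abelian
lattice (discrete; cocompactness is part of the structure), and there is a compact
central Lie subgroup `G₂` that contains `[G, G]` and meets `Λ` trivially. -/
def IsGood (A : TranslationalSystem.{u, w} Γ) : Prop :=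
  PolishSpace A.G ∧
  (∃ _ : Group.IsNilpotent A.G, Group.nilpotencyClass A.G ≤ 2) ∧
  DiscreteTopology A.Λ ∧
  (∀ a ∈ A.Λ, ∀ b ∈ A.Λ, a * b = b * a) ∧
  ∃ G₂ : Subgroup A.G, IsCompact (G₂ : Set A.G) ∧ IsRealLieGroup G₂ ∧
    G₂ ≤ Subgroup.center A.G ∧ commutator A.G ≤ G₂ ∧ A.Λ ⊓ G₂ = ⊥

end TranslationalSystem

end CLSystem

/-!
The idea is to realise `Z ⋊_ρ K` as a homogeneous space of its Host--Kra group. Let `G` be the set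
of pairs `(z, F)`, with `z ∈ Z` and `F : Z → K` measurable modulo null sets, for which
`ρ_γ(z + ·) - ρ_γ - (F(φ(γ) + ·) - F)` is almost everywhere constant for every `γ`. It is a group
under `(z, F) (z', F') = (z + z', F(z' + ·) + F')`, the composition law of the maps
`(x, k) ↦ (z + x, k + F(x))`, and `γ ↦ (φ(γ), ρ_γ)` is a homomorphism `Γ → G` (`hostKraHom`).

*Topology of `G`.* A compact metrizable abelian group has an invariant metric, so `Z` and `K` may be
taken to be normed groups, and measurable maps `Z → K` are the elements of `Lp K 1 μ`. This makes `G`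
a closed subgroup of a Polish group with a complete right-invariant metric. The Conze--Lesigne
equation says that `(z, F) ↦ z` maps `G` onto `Z`; completeness and Baire's theorem make this map
open (`mem_nhds_image_ball_of_rightInvariant`).

*The kernel.* If `(0, F) ∈ G`, ergodicity of `Z` shows that `F(z + ·) - F` is a constant `χ(z)` for
every `z ∈ Z`, that `χ` is a continuous homomorphism `Z → K`, and that `F - χ` is constant
(`exists_character`, `exists_continuousMap_ae_eq`). When `F` is small, `χ` has small image; as a Lie
group has no small subgroups, `χ = 0` (`exists_forall_norm_lt_mem_range_const`). Hence the kernel is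
the product of the compact central group `G₂ ≅ K` of constants and of a discrete group, and `G`, an
extension of a compact group by it, is locally compact. Ergodicity also puts all commutators into
`G₂`, which makes `G` nilpotent of class at most two and unimodular.

*The isomorphism.* For `z₀ ∈ Z` the elements `(0, F)` of `G` for which the continuous version of `F`
vanishes at `z₀` form a discrete cocompact subgroup `Λ`, a complement of `G₂` in the kernel. It plays
the role of the stabiliser of `(z₀, 0)`, and `(z, F) ↦ (z + z₀, F(z₀))` that of the orbit map. Since
`F(z₀)` makes no sense for a single class `F`, the orbit map is replaced by a Borel section of
`G → Z`, read through a jointly measurable version of `(z, x) ↦ F_z(x)`. Fubini's theorem yields a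
`z₀` at which the relations between these functions hold for almost every `z`, and for it the section
can be normalised so as to intertwine the two actions (`exists_normalized_section`). The resulting
Borel bijection `Z × K → G ⧸ Λ` is a Borel isomorphism by the Lusin--Souslin theorem, and the image
of the product measure is `G`-invariant because every `g ∈ G` acts on `Z × K` as a skew translation.
-/

namespace CLSystem

open Set Filter Topology
open scoped Pointwise commutatorElement

set_option linter.unusedSectionVars false

/-! ### Invariant metrics, open mappings and measurable sections -/

/-- A compact metrizable abelian group as a normed group. The invariant metric
`d(x, y) = sup_k d₀(x + k, y + k)` is induced by the embedding `x ↦ (k ↦ x + k)` into `C(K, K)`. The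
group structure and the topology are definitionally the given ones. -/
noncomputable abbrev normedAddCommGroupOfCompact (K : Type*) [AddCommGroup K] [TopologicalSpace K]
    [IsTopologicalAddGroup K] [CompactSpace K] [TopologicalSpace.MetrizableSpace K] :
    NormedAddCommGroup K :=
  letI m : MetricSpace K := TopologicalSpace.metrizableSpaceMetric K
  let ι : K → C(K, K) := fun x => ⟨fun k => x + k, by fun_prop⟩
  have hι : IsEmbedding ι :=
    IsEmbedding.of_leftInverse (f := fun f : C(K, K) => f 0) (g := ι) (fun x => by simp [ι])
      (by fun_prop)
      (ContinuousMap.continuous_of_continuous_uncurry _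
        (by simp only [ι, Function.uncurry_def, ContinuousMap.coe_mk]; fun_prop))
  have inv : ∀ a x y : K, dist (ι (a + x)) (ι (a + y)) = dist (ι x) (ι y) := by
    have key : ∀ a x y : K, dist (ι (a + x)) (ι (a + y)) ≤ dist (ι x) (ι y) := by
      intro a x y
      refine (ContinuousMap.dist_le dist_nonneg).2 fun k => ?_
      have := ContinuousMap.dist_apply_le_dist (f := ι x) (g := ι y) (a + k)
      simp only [ι, ContinuousMap.coe_mk] at this ⊢
      rwa [add_comm a x, add_comm a y, add_assoc, add_assoc]
    intro a x y
    refine le_antisymm (key a x y) ?_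
    have := key (-a) (a + x) (a + y)
    rwa [neg_add_cancel_left, neg_add_cancel_left] at this
  { ‹AddCommGroup K› with
    norm := fun x => dist (ι x) (ι 0)
    toMetricSpace := hι.comapMetricSpace
    dist_eq := fun x y => by
      change dist (ι x) (ι y) = dist (ι (-x + y)) (ι 0)
      rw [← inv (-x) x y, neg_add_cancel, dist_comm] }

/-- The open mapping theorem at the identity, for a surjective homomorphism from a separable group
with a complete right-invariant metric. By Baire's theorem closures of images of balls are
neighbourhoods of `0`; successive approximation, where right invariance makes the partial products
a Cauchy sequence, then removes the closure. -/
theorem mem_nhds_image_ball_of_rightInvariant {G Z : Type*} [Group G] [MetricSpace G]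
    [CompleteSpace G] [SecondCountableTopology G] [NormedAddCommGroup Z] [BaireSpace Z]
    (hinv : ∀ a b c : G, dist (a * c) (b * c) = dist a b)
    (f : G → Z) (hmul : ∀ a b, f (a * b) = f a + f b) (hf : Continuous f)
    (hsurj : Function.Surjective f) {r : ℝ} (hr : 0 < r) :
    f '' Metric.ball 1 r ∈ 𝓝 (0 : Z) := by
  have h1 : f 1 = 0 := by simpa using hmul 1 1
  have hdiv : ∀ a b, f (a * b⁻¹) = f a - f b := fun a b => by
    have := hmul (a * b⁻¹) b
    rw [inv_mul_cancel_right] at this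
    rw [this, add_sub_cancel_right]
  have hdiv1 : ∀ a b : G, dist (a * b⁻¹) 1 = dist a b := fun a b => by
    rw [← hinv a b b⁻¹, mul_inv_cancel]
  have dense : ∀ r : ℝ, 0 < r → closure (f '' Metric.ball 1 r) ∈ 𝓝 (0 : Z) := by
    intro r hr
    obtain ⟨n, hn⟩ := nonempty_interior_of_iUnion_of_closed
      (f := fun n => closure (f '' Metric.ball (TopologicalSpace.denseSeq G n) (r / 2)))
      (fun _ => isClosed_closure) (by
        refine eq_univ_of_forall fun z => ?_
        obtain ⟨g, rfl⟩ := hsurj z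
        obtain ⟨_, hn, ⟨n, rfl⟩⟩ :=
          Metric.dense_iff.1 (TopologicalSpace.denseRange_denseSeq G) g (r / 2) (by positivity)
        rw [mem_iUnion]
        exact ⟨n, subset_closure ⟨g, by rwa [Metric.mem_ball, dist_comm], rfl⟩⟩)
    obtain ⟨w, hw⟩ := hn
    have hw' := mem_interior_iff_mem_nhds.1 hw
    have hT : Tendsto (fun z : Z => w + z) (𝓝 0) (𝓝 w) := by
      have : Continuous fun z : Z => w + z := by fun_prop
      simpa using this.tendsto 0
    filter_upwards [hT hw'] with z hz
    have hz2 := mem_of_mem_nhds hw'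
    have : z = (w + z) - w := by abel
    rw [this]
    refine map_mem_closure₂ continuous_sub hz hz2 ?_
    rintro _ ⟨a, ha, rfl⟩ _ ⟨b, hb, rfl⟩
    refine ⟨a * b⁻¹, ?_, hdiv a b⟩
    rw [Metric.mem_ball, hdiv1]
    calc dist a b ≤ dist a _ + dist b _ := dist_triangle_right _ _ _
      _ < r / 2 + r / 2 := add_lt_add ha hb
      _ = r := by ring
  have step : ∀ (n : ℕ) (y : Z), y ∈ closure (f '' Metric.ball 1 (r / 4 * (1 / 2) ^ n)) →
      ∃ g : G, dist g 1 < r / 4 * (1 / 2) ^ n ∧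
        y - f g ∈ closure (f '' Metric.ball 1 (r / 4 * (1 / 2) ^ (n + 1))) := by
    intro n y hy
    have hT : Tendsto (fun z : Z => y - z) (𝓝 y) (𝓝 0) := by
      have : Continuous fun z : Z => y - z := by fun_prop
      simpa using this.tendsto y
    obtain ⟨_, h, ⟨g, hg, rfl⟩⟩ := mem_closure_iff_nhds.1 hy _
      (hT (dense (r / 4 * (1 / 2) ^ (n + 1)) (by positivity)))
    exact ⟨g, hg, h⟩
  choose! g hg1 hg2 using step
  refine mem_of_superset (dense (r / 4) (by positivity)) fun y hy => ?_
  -- `(s n).1` is the remainder and `(s n).2` the product of the first `n` approximations; new factors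
  -- enter on the left, so that right invariance bounds the distance of consecutive products.
  let s : ℕ → Z × G := fun n => Nat.rec (y, 1) (fun n q => (q.1 - f (g n q.1), g n q.1 * q.2)) n
  have s1 : ∀ n, (s (n + 1)).1 = (s n).1 - f (g n (s n).1) := fun _ => rfl
  have s2 : ∀ n, (s (n + 1)).2 = g n (s n).1 * (s n).2 := fun _ => rfl
  have hs : ∀ n, (s n).1 ∈ closure (f '' Metric.ball 1 (r / 4 * (1 / 2) ^ n)) := by
    intro n
    induction n with
    | zero => simpa [s] using hy
    | succ n ih => rw [s1]; exact hg2 n _ ih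
  have hsum : ∀ n, f (s n).2 + (s n).1 = y := by
    intro n
    induction n with
    | zero => simp [s, h1]
    | succ n ih => rw [s1, s2, hmul, ← ih]; abel
  have hd : ∀ n, dist (s n).2 (s (n + 1)).2 ≤ r / 2 / 2 / 2 ^ n := by
    intro n
    rw [s2, dist_comm]
    have := hinv (g n (s n).1) 1 (s n).2
    rw [one_mul] at this
    rw [this]
    refine (hg1 n _ (hs n)).le.trans (le_of_eq ?_)
    rw [one_div, inv_pow]; ring
  obtain ⟨p, hp⟩ := cauchySeq_tendsto_of_complete (cauchySeq_of_le_geometric_two hd)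
  have hp1 := dist_le_of_le_geometric_two_of_tendsto₀ hd hp
  refine ⟨p, ?_, ?_⟩
  · rw [Metric.mem_ball, dist_comm]
    exact lt_of_le_of_lt hp1 (by linarith)
  · have hy0 : Tendsto (fun n => (s n).1) atTop (𝓝 0) := by
      rw [Metric.tendsto_atTop]
      intro ε hε
      obtain ⟨δ, hδ, hδ2⟩ := Metric.continuous_iff.1 hf 1 (ε / 2) (by positivity)
      have hlim : Tendsto (fun n : ℕ => r / 4 * (1 / 2 : ℝ) ^ n) atTop (𝓝 0) := by
        simpa using (tendsto_pow_atTop_nhds_zero_of_lt_one (r := (1 / 2 : ℝ)) (by norm_num)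
          (by norm_num)).const_mul (r / 4)
      obtain ⟨N, hN⟩ := (hlim.eventually (gt_mem_nhds hδ)).exists_forall_of_atTop
      refine ⟨N, fun n hn => ?_⟩
      have : (s n).1 ∈ Metric.closedBall (0 : Z) (ε / 2) := by
        refine closure_minimal ?_ Metric.isClosed_closedBall (hs n)
        rintro _ ⟨a, ha, rfl⟩
        have := hδ2 a (lt_trans ha (hN n hn))
        rw [h1] at this
        exact this.le
      exact lt_of_le_of_lt this (by linarith)
    have h2 := ((hf.tendsto p).comp hp).add hy0
    simp only [Function.comp_def, hsum, add_zero] at h2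
    exact (tendsto_nhds_unique tendsto_const_nhds h2).symm

/-- A continuous open surjection from a Polish metric space has a Borel section. It is the uniform
limit of maps `S n` with values in a countable dense set for which `S n z` lies within `2⁻ⁿ` of the
fibre over `z`; openness of `f` makes the latter condition measurable in `z`. -/
theorem exists_measurable_rightInverse {G Z : Type*} [MetricSpace G] [CompleteSpace G]
    [SecondCountableTopology G] [MeasurableSpace G] [BorelSpace G] [TopologicalSpace Z]
    [T2Space Z] [MeasurableSpace Z] [OpensMeasurableSpace Z] [Nonempty G] {f : G → Z}
    (hf : Continuous f) (ho : IsOpenMap f) (hs : Function.Surjective f) :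
    ∃ s : Z → G, Measurable s ∧ ∀ z, f (s z) = z := by
  classical
  let D := TopologicalSpace.denseSeq G
  have hD : ∀ (g : G) (ε : ℝ), 0 < ε → ∃ j, dist (D j) g < ε := fun g ε hε => by
    obtain ⟨_, hn, ⟨n, rfl⟩⟩ :=
      Metric.dense_iff.1 (TopologicalSpace.denseRange_denseSeq G) g ε hε
    exact ⟨n, hn⟩
  have step : ∀ (n : ℕ) (s : Z → G), Measurable s →
      (∀ z, z ∈ f '' Metric.ball (s z) ((1 / 2) ^ n)) →
      ∃ t : Z → G, Measurable t ∧ (∀ z, z ∈ f '' Metric.ball (t z) ((1 / 2) ^ (n + 1))) ∧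
        ∀ z, dist (s z) (t z) < (1 / 2) ^ n := by
    intro n s hsm hsz
    have hex : ∀ z, ∃ j, dist (s z) (D j) < (1 / 2) ^ n ∧
        z ∈ f '' Metric.ball (D j) ((1 / 2) ^ (n + 1)) := by
      intro z
      obtain ⟨g, hg, hgz⟩ := hsz z
      rw [Metric.mem_ball] at hg
      obtain ⟨j, hj⟩ := hD g (min ((1 / 2) ^ (n + 1)) ((1 / 2) ^ n - dist g (s z)))
        (lt_min (by positivity) (by linarith))
      refine ⟨j, ?_, g, ?_, hgz⟩
      · have := (hj.trans_le (min_le_right _ _))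
        have h3 := dist_triangle_right (s z) (D j) g
        rw [dist_comm (s z) g] at h3
        linarith
      · rw [Metric.mem_ball, dist_comm]
        exact hj.trans_le (min_le_left _ _)
    refine ⟨fun z => D (Nat.find (hex z)), ?_, fun z => (Nat.find_spec (hex z)).2,
      fun z => (Nat.find_spec (hex z)).1⟩
    refine Measurable.find (f := fun j _ => D j) (fun _ => measurable_const) (fun j => ?_) hex
    exact (measurableSet_lt (hsm.dist measurable_const) measurable_const).inter
      (ho _ Metric.isOpen_ball).measurableSet
  have start : ∃ t : Z → G, Measurable t ∧ ∀ z, z ∈ f '' Metric.ball (t z) ((1 / 2) ^ 0) := by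
    have hex : ∀ z, ∃ j, z ∈ f '' Metric.ball (D j) ((1 / 2) ^ 0) := by
      intro z
      obtain ⟨g, rfl⟩ := hs z
      obtain ⟨j, hj⟩ := hD g ((1 / 2) ^ 0) (by positivity)
      exact ⟨j, g, by rwa [Metric.mem_ball, dist_comm], rfl⟩
    exact ⟨fun z => D (Nat.find (hex z)),
      Measurable.find (f := fun j _ => D j) (fun _ => measurable_const)
        (fun j => (ho _ Metric.isOpen_ball).measurableSet) hex, fun z => Nat.find_spec (hex z)⟩
  obtain ⟨t₀, ht₀, ht₀'⟩ := start
  choose! nx hn1 hn2 hn3 using step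
  let S : ℕ → Z → G := fun n => Nat.rec t₀ (fun n s => nx n s) n
  have hS : ∀ n, Measurable (S n) ∧ ∀ z, z ∈ f '' Metric.ball (S n z) ((1 / 2) ^ n) := by
    intro n
    induction n with
    | zero => exact ⟨ht₀, ht₀'⟩
    | succ n ih => exact ⟨hn1 n _ ih.1 ih.2, hn2 n _ ih.1 ih.2⟩
  have hd : ∀ z n, dist (S n z) (S (n + 1) z) ≤ 2 / 2 / 2 ^ n := by
    intro z n
    refine (hn3 n _ (hS n).1 (hS n).2 z).le.trans (le_of_eq ?_)
    rw [one_div, inv_pow]; ring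
  have hlim : ∀ z, ∃ g, Tendsto (fun n => S n z) atTop (𝓝 g) := fun z =>
    cauchySeq_tendsto_of_complete (cauchySeq_of_le_geometric_two (hd z))
  choose s hs' using hlim
  refine ⟨s, measurable_of_tendsto_metrizable (fun n => (hS n).1) (tendsto_pi_nhds.2 hs'),
    fun z => ?_⟩
  choose g hg hgz using fun n => (hS n).2 z
  have hg' : Tendsto g atTop (𝓝 (s z)) := by
    refine (tendsto_iff_of_dist (f₁ := fun n => S n z) ?_).1 (hs' z)
    refine squeeze_zero (fun _ => dist_nonneg) (g := fun n => (1 / 2 : ℝ) ^ n) (fun n => ?_)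
      (tendsto_pow_atTop_nhds_zero_of_lt_one (by norm_num) (by norm_num))
    rw [dist_comm]; exact (hg n).le
  have h2 := (hf.tendsto _).comp hg'
  simp only [Function.comp_def, hgz] at h2
  exact (tendsto_nhds_unique tendsto_const_nhds h2).symm

/-! ### Real Lie groups: transport of structure, and no small subgroups -/

/-- A Lie group structure can be pulled back along an isomorphism of topological groups, here from
additive to multiplicative notation. -/
theorem IsRealLieAddGroup.isRealLieGroup_of_homeomorph {K G : Type*} [TopologicalSpace K]
    [AddGroup K] (hK : IsRealLieAddGroup K) [TopologicalSpace G] [Group G] (h : G ≃ₜ K)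
    (hmul : ∀ a b, h (a * b) = h a + h b) : IsRealLieGroup G := by
  obtain ⟨n, cK, hL⟩ := hK
  let E := EuclideanSpace ℝ (Fin n)
  let cG : ChartedSpace E G :=
    { atlas := (fun e => h.toOpenPartialHomeomorph.trans e) '' (atlas E K)
      chartAt := fun g => h.toOpenPartialHomeomorph.trans (chartAt E (h g))
      mem_chart_source := fun g => by simp
      chart_mem_atlas := fun g => mem_image_of_mem _ (chart_mem_atlas E (h g)) }
  have hK' : IsManifold (𝓡 n) ∞ K := hL.toIsManifold
  have hG : IsManifold (𝓡 n) ∞ G := by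
    refine { compatible := ?_ }
    rintro _ _ ⟨e, he, rfl⟩ ⟨e', he', rfl⟩
    refine StructureGroupoid.mem_of_eqOnSource _ (hK'.compatible he he') ?_
    rw [OpenPartialHomeomorph.trans_symm_eq_symm_trans_symm, OpenPartialHomeomorph.trans_assoc,
      ← OpenPartialHomeomorph.trans_assoc h.toOpenPartialHomeomorph.symm,
      ← Homeomorph.symm_toOpenPartialHomeomorph, ← Homeomorph.trans_toOpenPartialHomeomorph,
      Homeomorph.symm_trans_self, Homeomorph.refl_toOpenPartialHomeomorph,
      OpenPartialHomeomorph.refl_trans]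
  have hh : ContMDiff (𝓡 n) (𝓡 n) ∞ h := by
    intro g
    rw [contMDiffAt_iff]
    refine ⟨h.continuous.continuousAt, ?_⟩
    have := (contMDiffAt_iff.1 (contMDiffAt_id (I := 𝓡 n) (n := ∞) (x := h g))).2
    have e1 : extChartAt (𝓡 n) (h g) ∘ h ∘ (extChartAt (𝓡 n) g).symm =
        extChartAt (𝓡 n) (h g) ∘ id ∘ (extChartAt (𝓡 n) (h g)).symm := by
      funext y
      exact congrArg (extChartAt (𝓡 n) (h g)) (h.apply_symm_apply _)
    rw [e1]
    exact this
  have hs : ContMDiff (𝓡 n) (𝓡 n) ∞ h.symm := by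
    intro k
    obtain ⟨g, rfl⟩ := h.surjective k
    rw [contMDiffAt_iff]
    refine ⟨h.symm.continuous.continuousAt, ?_⟩
    have := (contMDiffAt_iff.1 (contMDiffAt_id (I := 𝓡 n) (n := ∞) (x := h g))).2
    rw [h.symm_apply_apply]
    have e1 : extChartAt (𝓡 n) g ∘ h.symm ∘ (extChartAt (𝓡 n) (h g)).symm =
        extChartAt (𝓡 n) (h g) ∘ id ∘ (extChartAt (𝓡 n) (h g)).symm := by
      funext y
      exact congrArg (extChartAt (𝓡 n) (h g)) (h.apply_symm_apply _)
    rw [e1]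
    exact this
  have hadd := hL.contMDiff_add
  have hneg := hL.contMDiff_neg
  have hinv : ∀ a, h a⁻¹ = - h a := fun a => by
    have h1 : h 1 = 0 := by simpa using hmul 1 1
    rw [eq_neg_iff_add_eq_zero, ← hmul, inv_mul_cancel, h1]
  refine ⟨n, cG, ?_⟩
  refine { toIsManifold := hG, contMDiff_mul := ?_, contMDiff_inv := ?_ }
  · have := hs.comp (hadd.comp ((hh.comp contMDiff_fst).prodMk (hh.comp contMDiff_snd)))
    refine this.congr fun p => ?_
    simp [← hmul]
  · have := hs.comp (hneg.comp hh)
    refine this.congr fun p => ?_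
    simp [← hinv]

/-- A Lie group has no small subgroups: the doubling map has derivative `2` at `0`, so near `0` it
increases the distance to `0` in a chart by a factor of at least `3 / 2`. -/
theorem IsRealLieAddGroup.exists_nhds_no_small_subgroups {K : Type*} [TopologicalSpace K]
    [AddGroup K] (hK : IsRealLieAddGroup K) :
    ∃ U ∈ 𝓝 (0 : K), ∀ H : AddSubgroup K, (H : Set K) ⊆ U → H = ⊥ := by
  obtain ⟨n, cK, hL⟩ := hK
  have hadd := hL.contMDiff_add
  let E := EuclideanSpace ℝ (Fin n)
  have h1 : MDifferentiableAt ((𝓡 n).prod (𝓡 n)) (𝓡 n)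
      (fun p : K × K => p.1 + p.2) ((0 : K), (0 : K)) :=
    hadd.mdifferentiableAt (by simp)
  have h2 : MDifferentiableAt (𝓡 n) ((𝓡 n).prod (𝓡 n)) (fun x : K => (x, x)) 0 :=
    mdifferentiableAt_id.prodMk mdifferentiableAt_id
  have h3 : MDifferentiableAt (𝓡 n) (𝓡 n) ((fun p : K × K => p.1 + p.2) ∘ fun x : K => (x, x)) 0 :=
    MDifferentiableAt.comp (f := fun x : K => (x, x)) (0 : K) h1 h2
  have h4 : ∀ v : E, (mfderiv (𝓡 n) (𝓡 n) ((fun p : K × K => p.1 + p.2) ∘ fun x : K => (x, x)) 0 :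
      E →L[ℝ] E) v = v + v := by
    intro v
    rw [mfderiv_comp (f := fun x : K => (x, x)) (0 : K) h1 h2]
    have : (mfderiv (𝓡 n) ((𝓡 n).prod (𝓡 n)) (fun x : K => (x, x)) 0) =
      (ContinuousLinearMap.id ℝ E).prod (ContinuousLinearMap.id ℝ E) := by
      exact ((hasMFDerivAt_id (I := 𝓡 n) (0:K)).prodMk (hasMFDerivAt_id (0:K))).mfderiv
    rw [this]
    refine (mfderiv_prod_eq_add_apply h1).trans ?_
    have hid : ∀ f : K → K, f = id → ∀ v : E,
        (mfderiv (𝓡 n) (𝓡 n) f 0 : E →L[ℝ] E) v = v := by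
      rintro _ rfl v
      rw [mfderiv_id]; rfl
    exact congrArg₂ (· + ·) (hid _ (by funext z; simp) v) (hid _ (by funext z; simp) v)
  let u := extChartAt (𝓡 n) (0 : K)
  have h5 : HasFDerivAt (u ∘ (fun x : K => x + x) ∘ u.symm)
      ((2 : ℝ) • ContinuousLinearMap.id ℝ E) (u 0) := by
    have hd : (mfderiv (𝓡 n) (𝓡 n) ((fun p : K × K => p.1 + p.2) ∘ fun x : K => (x, x)) 0 :
        E →L[ℝ] E) = (2 : ℝ) • ContinuousLinearMap.id ℝ E := by
      exact ContinuousLinearMap.ext fun v => (h4 v).trans (two_smul ℝ v).symm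
    have h := h3.hasMFDerivAt.2
    simp only [modelWithCornersSelf_coe, range_id] at h
    have h' := HasFDerivWithinAt.hasFDerivAt h univ_mem
    have hw : writtenInExtChartAt (𝓡 n) (𝓡 n) 0
        ((fun p : K × K => p.1 + p.2) ∘ fun x : K => (x, x)) =
        u ∘ (fun x : K => x + x) ∘ u.symm := by
      simp only [writtenInExtChartAt, u, Function.comp_apply, add_zero]
      rfl
    rw [hw] at h'
    exact hd ▸ h'
  have h6 : ∀ᶠ y in 𝓝 (u 0), ‖(u ∘ (fun x : K => x + x) ∘ u.symm) y - u 0 - (2 : ℝ) • (y - u 0)‖ ≤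
      1 / 2 * ‖y - u 0‖ := by
    have h := h5.isLittleO.def (c := 1 / 2) (by norm_num)
    have h0 : (u ∘ (fun x : K => x + x) ∘ u.symm) (u 0) = u 0 := by simp [u]
    rw [h0] at h
    exact h
  have hc : ContinuousAt u 0 := continuousAt_extChartAt (0 : K)
  have hsrc : u.source ∈ 𝓝 (0 : K) := extChartAt_source_mem_nhds 0
  have h7 : ∀ᶠ x in 𝓝 (0 : K), x ∈ u.source ∧ 3 / 2 * ‖u x - u 0‖ ≤ ‖u (x + x) - u 0‖ ∧
      ‖u x - u 0‖ < 1 := by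
    filter_upwards [hsrc, hc.eventually h6, hc.eventually (Metric.ball_mem_nhds (u 0) one_pos)]
      with x hx1 hx2 hx3
    refine ⟨hx1, ?_, by rwa [← dist_eq_norm]⟩
    simp only [Function.comp_apply, u.left_inv hx1] at hx2
    have h8 := norm_sub_norm_le ((2 : ℝ) • (u x - u 0)) (u (x + x) - u 0)
    rw [norm_sub_rev ((2 : ℝ) • _), norm_smul] at h8
    norm_num at h8 hx2
    linarith
  refine ⟨_, h7, fun H hH => ?_⟩
  rw [eq_bot_iff]
  intro x hx
  have grow : ∀ m : ℕ, (3 / 2 : ℝ) ^ m * ‖u x - u 0‖ ≤ ‖u (2 ^ m • x) - u 0‖ := by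
    intro m
    induction m with
    | zero => simp
    | succ m ih =>
      have := (hH (H.nsmul_mem hx (2 ^ m))).2.1
      rw [← two_nsmul, ← mul_nsmul', ← pow_succ'] at this
      refine le_trans ?_ this
      rw [pow_succ']
      linarith
  have h0 : ‖u x - u 0‖ = 0 := by
    by_contra hne
    have hpos : 0 < ‖u x - u 0‖ := lt_of_le_of_ne (norm_nonneg _) (Ne.symm hne)
    obtain ⟨m, hm⟩ := pow_unbounded_of_one_lt (1 / ‖u x - u 0‖) (by norm_num : (1 : ℝ) < 3 / 2)
    rw [div_lt_iff₀ hpos] at hm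
    have := (hH (H.nsmul_mem hx (2 ^ m))).2.2
    linarith [grow m]
  exact u.injOn (hH hx).1 (mem_of_mem_nhds hsrc) (sub_eq_zero.1 (norm_eq_zero.1 h0))

/-! ### Translations of function classes and the Host--Kra group -/

section Translate

variable {Z : Type*} [NormedAddCommGroup Z] [MeasurableSpace Z] [BorelSpace Z]
  {μ : Measure Z} [μ.IsAddLeftInvariant]
  {K : Type*} [NormedAddCommGroup K]

/-- Translation of (classes of) functions `Z → K`: `translate z F` is `x ↦ F (z + x)`. -/
noncomputable def translate (z : Z) : Lp K 1 μ →+ Lp K 1 μ :=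
  Lp.compMeasurePreserving (z + ·) (measurePreserving_add_left μ z)

theorem coeFn_translate (z : Z) (F : Lp K 1 μ) : translate z F =ᵐ[μ] fun x => F (z + x) :=
  Lp.coeFn_compMeasurePreserving F _

theorem translate_zero (F : Lp K 1 μ) : translate 0 F = F := by
  refine Lp.ext ((coeFn_translate 0 F).trans ?_)
  simp

theorem translate_add (a b : Z) (F : Lp K 1 μ) :
    translate (a + b) F = translate a (translate b F) := by
  refine Lp.ext ((coeFn_translate _ F).trans ?_)
  have h1 := (measurePreserving_add_left μ a).quasiMeasurePreserving.ae (coeFn_translate b F)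
  filter_upwards [coeFn_translate a (translate b F), h1] with x hx hx1
  rw [hx, hx1, add_left_comm, add_assoc]

theorem translate_comm (a b : Z) (F : Lp K 1 μ) :
    translate a (translate b F) = translate b (translate a F) := by
  rw [← translate_add, add_comm, translate_add]

theorem norm_translate (z : Z) (F : Lp K 1 μ) : ‖translate z F‖ = ‖F‖ :=
  Lp.norm_compMeasurePreserving _ _

theorem dist_translate (z : Z) (F F' : Lp K 1 μ) :
    dist (translate z F) (translate z F') = dist F F' :=
  (Lp.isometry_compMeasurePreserving _).dist_eq _ _

theorem _root_.Continuous.lpTranslate [CompactSpace Z] [IsFiniteMeasure μ] {X : Type*}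
    [TopologicalSpace X] {f : X → Z} {F : X → Lp K 1 μ} (hf : Continuous f) (hF : Continuous F) :
    Continuous fun x => translate (f x) (F x) :=
  hF.compMeasurePreservingLp (g := fun p => ⟨fun x => f p + x, by fun_prop⟩)
    (ContinuousMap.continuous_of_continuous_uncurry _
      (by simp only [Function.uncurry_def, ContinuousMap.coe_mk]; fun_prop))
    (fun p => measurePreserving_add_left μ (f p)) (by simp)

variable [IsProbabilityMeasure μ]

theorem translate_const (z : Z) (k : K) :
    translate z (Lp.const 1 μ k) = Lp.const 1 μ k := by
  refine Lp.ext ((coeFn_translate _ _).trans ?_)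
  have h1 := (measurePreserving_add_left μ z).quasiMeasurePreserving.ae
    (Lp.coeFn_const (p := 1) (μ := μ) k)
  filter_upwards [h1, Lp.coeFn_const (p := 1) (μ := μ) k] with x hx hx1
  rw [hx, hx1]; rfl

theorem norm_Lp_const (k : K) : ‖Lp.const 1 μ k‖ = ‖k‖ := by
  rw [Lp.norm_const _ _ _ (by simp)]
  simp

theorem isometry_Lp_const : Isometry (Lp.const 1 μ : K → Lp K 1 μ) :=
  AddMonoidHomClass.isometry_of_norm _ norm_Lp_const

theorem isCompact_range_const [CompactSpace K] :
    IsCompact ((Lp.const 1 μ : K →+ Lp K 1 μ).range : Set (Lp K 1 μ)) := by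
  rw [AddMonoidHom.coe_range]
  exact isCompact_range isometry_Lp_const.continuous

end Translate

/-! ### The group of skew translations -/

section Skew

variable {Z : Type*} [NormedAddCommGroup Z] [MeasurableSpace Z] [BorelSpace Z]
  (μ : Measure Z) [μ.IsAddLeftInvariant]
  (K : Type*) [NormedAddCommGroup K]

/-- The group of pairs `(z, F)` acting on `Z × K` by `(x, k) ↦ (z + x, k + F x)`, for almost every
`x`. It carries the product metric, which is complete and invariant under right translations. -/
def SkewGroup : Type _ := Z × Lp K 1 μ

variable {μ K}
namespace SkewGroup

noncomputable instance : MetricSpace (SkewGroup μ K) := inferInstanceAs (MetricSpace (Z × Lp K 1 μ))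

instance [CompactSpace Z] [CompactSpace K] : CompleteSpace (SkewGroup μ K) :=
  inferInstanceAs (CompleteSpace (Z × Lp K 1 μ))

instance [CompactSpace Z] [CompactSpace K] [IsFiniteMeasure μ] :
    SecondCountableTopology (SkewGroup μ K) :=
  haveI : SecondCountableTopology Z := UniformSpace.secondCountable_of_separable Z
  haveI : Fact ((1 : ENNReal) ≠ ⊤) := ⟨by simp⟩
  inferInstanceAs (SecondCountableTopology (Z × Lp K 1 μ))

/-- The pair `(z, F)` as an element of `SkewGroup μ K`. -/
def mk (z : Z) (F : Lp K 1 μ) : SkewGroup μ K := (z, F)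

@[simp] theorem mk_fst (z : Z) (F : Lp K 1 μ) : (mk z F).1 = z := rfl
@[simp] theorem mk_snd (z : Z) (F : Lp K 1 μ) : (mk z F).2 = F := rfl

noncomputable instance : Mul (SkewGroup μ K) :=
  ⟨fun g h => mk (g.1 + h.1) (translate h.1 g.2 + h.2)⟩

noncomputable instance : One (SkewGroup μ K) := ⟨mk 0 0⟩

noncomputable instance : Inv (SkewGroup μ K) := ⟨fun g => mk (-g.1) (-translate (-g.1) g.2)⟩

@[simp] theorem mul_fst (g h : SkewGroup μ K) : (g * h).1 = g.1 + h.1 := rfl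
@[simp] theorem mul_snd (g h : SkewGroup μ K) : (g * h).2 = translate h.1 g.2 + h.2 := rfl
@[simp] theorem one_fst : (1 : SkewGroup μ K).1 = 0 := rfl
@[simp] theorem one_snd : (1 : SkewGroup μ K).2 = 0 := rfl
@[simp] theorem inv_fst (g : SkewGroup μ K) : g⁻¹.1 = -g.1 := rfl
@[simp] theorem inv_snd (g : SkewGroup μ K) : g⁻¹.2 = -translate (-g.1) g.2 := rfl

@[ext] theorem ext {g h : SkewGroup μ K} (h1 : g.1 = h.1) (h2 : g.2 = h.2) : g = h :=
  Prod.ext h1 h2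

noncomputable instance : Group (SkewGroup μ K) :=
  Group.ofLeftAxioms
    (fun a b c => SkewGroup.ext (by simp [add_assoc])
      (by simp [add_comm b.1, translate_add, add_assoc]))
    (fun a => SkewGroup.ext (by simp) (by simp))
    (fun a => SkewGroup.ext (by simp) (by simp [← translate_add, translate_zero]))

theorem dist_eq (g h : SkewGroup μ K) : dist g h = max (dist g.1 h.1) (dist g.2 h.2) := rfl

theorem dist_mul_right (a b c : SkewGroup μ K) : dist (a * c) (b * c) = dist a b := by
  simp [dist_eq, dist_translate]

theorem continuous_fst : Continuous fun g : SkewGroup μ K => g.1 :=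
  _root_.continuous_fst (X := Z) (Y := Lp K 1 μ)

theorem continuous_snd : Continuous fun g : SkewGroup μ K => g.2 :=
  _root_.continuous_snd (X := Z) (Y := Lp K 1 μ)

theorem _root_.Continuous.skewGroupMk {X : Type*} [TopologicalSpace X] {f : X → Z}
    {F : X → Lp K 1 μ} (hf : Continuous f) (hF : Continuous F) :
    Continuous fun x => (mk (f x) (F x) : SkewGroup μ K) :=
  hf.prodMk hF

instance [CompactSpace Z] [IsFiniteMeasure μ] : IsTopologicalGroup (SkewGroup μ K) where
  continuous_mul := by
    have h1 : Continuous fun p : SkewGroup μ K × SkewGroup μ K => p.1.1 :=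
      continuous_fst.comp _root_.continuous_fst
    have h2 : Continuous fun p : SkewGroup μ K × SkewGroup μ K => p.2.1 :=
      continuous_fst.comp _root_.continuous_snd
    have h3 : Continuous fun p : SkewGroup μ K × SkewGroup μ K => p.1.2 :=
      continuous_snd.comp _root_.continuous_fst
    have h4 : Continuous fun p : SkewGroup μ K × SkewGroup μ K => p.2.2 :=
      continuous_snd.comp _root_.continuous_snd
    exact (h1.add h2).skewGroupMk ((h2.lpTranslate h3).add h4)
  continuous_inv := by
    have h1 : Continuous fun g : SkewGroup μ K => -g.1 := continuous_fst.neg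
    exact h1.skewGroupMk (h1.lpTranslate continuous_snd).neg

end SkewGroup

end Skew

section HostKra
variable {Z : Type*} [NormedAddCommGroup Z] [MeasurableSpace Z] [BorelSpace Z]
  {μ : Measure Z} [μ.IsAddLeftInvariant] [IsProbabilityMeasure μ]
  {K : Type*} [NormedAddCommGroup K] {Γ : Type*} [AddCommGroup Γ]

/-- The Host--Kra group of a family `R` of function classes over the rotation by `φ`: the pairs
`(z, F)` for which the derivative of every `R γ` along `z` is the coboundary of `F` up to an additive
constant. If `R` is a cocycle, the constant is automatically additive in `γ`. -/
noncomputable def hostKra (φ : Γ →+ Z) (R : Γ → Lp K 1 μ) : Subgroup (SkewGroup μ K) where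
  carrier := {g | ∀ γ, translate g.1 (R γ) - R γ - (translate (φ γ) g.2 - g.2) ∈
    (Lp.const 1 μ : K →+ Lp K 1 μ).range}
  one_mem' γ := by simp [translate_zero, zero_mem]
  mul_mem' {g h} hg hh γ := by
    obtain ⟨k, hk⟩ := hg γ
    obtain ⟨l, hl⟩ := hh γ
    refine ⟨k + l, ?_⟩
    rw [map_add, hl, ← translate_const h.1 k, hk]
    simp only [SkewGroup.mul_fst, SkewGroup.mul_snd, map_add, map_sub,
      translate_comm h.1 (φ γ), add_comm g.1, translate_add]
    abel
  inv_mem' {g} hg γ := by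
    obtain ⟨k, hk⟩ := hg γ
    refine ⟨-k, ?_⟩
    rw [map_neg, ← translate_const (-g.1) k, hk]
    have h : translate (-g.1) (translate g.1 (R γ)) = R γ := by
      rw [← translate_add, neg_add_cancel, translate_zero]
    simp only [SkewGroup.inv_fst, SkewGroup.inv_snd, map_sub, map_neg, h,
      translate_comm (-g.1) (φ γ)]
    abel

variable {φ : Γ →+ Z} {R : Γ → Lp K 1 μ}

theorem isClosed_hostKra [CompactSpace Z] [CompactSpace K] :
    IsClosed (hostKra φ R : Set (SkewGroup μ K)) := by
  have : (hostKra φ R : Set (SkewGroup μ K)) = ⋂ γ,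
      (fun g : SkewGroup μ K => translate g.1 (R γ) - R γ - (translate (φ γ) g.2 - g.2)) ⁻¹'
        (Lp.const 1 μ : K →+ Lp K 1 μ).range := by
    ext g; simp only [mem_iInter]; rfl
  rw [this]
  refine isClosed_iInter fun γ => isCompact_range_const.isClosed.preimage ?_
  have h1 : Continuous fun g : SkewGroup μ K => translate g.1 (R γ) :=
    SkewGroup.continuous_fst.lpTranslate continuous_const
  have h2 : Continuous fun g : SkewGroup μ K => translate (φ γ) g.2 :=
    continuous_const.lpTranslate SkewGroup.continuous_snd
  exact (h1.sub continuous_const).sub (h2.sub SkewGroup.continuous_snd)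

/-- The vertical translation by `k`, as an element of the Host--Kra group. -/
noncomputable def hostKraConst (φ : Γ →+ Z) (R : Γ → Lp K 1 μ) (k : K) : hostKra φ R :=
  ⟨SkewGroup.mk 0 (Lp.const 1 μ k), fun γ => by
    simp [translate_zero, translate_const, zero_mem]⟩

/-- If `R` is a cocycle, then `γ ↦ (φ γ, R γ)` is a homomorphism to the Host--Kra group. -/
noncomputable def hostKraHom
    (hR : ∀ γ₁ γ₂, R (γ₁ + γ₂) = translate (φ γ₂) (R γ₁) + R γ₂) :
    Multiplicative Γ →* hostKra φ R :=
  MonoidHom.mk' (fun γ => ⟨SkewGroup.mk (φ γ.toAdd) (R γ.toAdd), fun γ' => by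
    have h1 := hR γ' γ.toAdd
    rw [add_comm, hR γ.toAdd γ'] at h1
    refine ⟨0, ?_⟩
    simp only [SkewGroup.mk_fst, SkewGroup.mk_snd]
    rw [map_zero, eq_comm]
    have := sub_eq_zero.2 h1.symm
    rw [← this]; abel⟩)
    (fun a b => Subtype.ext (SkewGroup.ext (by simp) (by simp [hR])))

end HostKra

/-! ### Local compactness, unimodularity and nilpotency -/

section General

/-- A locally compact group with relatively compact commutator subgroup is unimodular: a compact
neighbourhood `U₀ * C` of `1` is invariant under conjugation, so that right translation by `g` maps
it to a left translate of itself. -/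
theorem isMulRightInvariant_of_commutator_le_compact {G : Type*} [Group G] [TopologicalSpace G]
    [IsTopologicalGroup G] [LocallyCompactSpace G] [SecondCountableTopology G]
    [MeasurableSpace G] [BorelSpace G] (m : Measure G) [m.IsHaarMeasure] (C : Subgroup G)
    (hC : IsCompact (C : Set G)) (hcomm : commutator G ≤ C) :
    m.IsMulRightInvariant := by
  obtain ⟨U₀, hU₀, hU₀n⟩ := exists_compact_mem_nhds (1 : G)
  have hU : IsCompact (U₀ * (C : Set G)) := hU₀.mul hC
  have hUn : U₀ * (C : Set G) ∈ 𝓝 (1 : G) :=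
    mem_of_superset hU₀n fun x hx => ⟨x, hx, 1, C.one_mem, mul_one x⟩
  have hconj : ∀ g x : G, x ∈ U₀ * (C : Set G) → g * x * g⁻¹ ∈ U₀ * (C : Set G) := by
    rintro g _ ⟨u, hu, c, hc, rfl⟩
    have h1 : u⁻¹ * g * u * g⁻¹ ∈ C := hcomm (by
      have := Subgroup.commutator_mem_commutator (Subgroup.mem_top u⁻¹) (Subgroup.mem_top g)
      rwa [commutatorElement_def, inv_inv] at this)
    have h2 : g * c * g⁻¹ * c⁻¹ ∈ C := hcomm (by
      have := Subgroup.commutator_mem_commutator (Subgroup.mem_top g) (Subgroup.mem_top c)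
      rwa [commutatorElement_def] at this)
    refine ⟨u, hu, (u⁻¹ * g * u * g⁻¹) * ((g * c * g⁻¹ * c⁻¹) * c),
      C.mul_mem h1 (C.mul_mem h2 hc), ?_⟩
    simp only
    group
  refine ⟨fun g => ?_⟩
  have hpre : (fun x => x * g) ⁻¹' (U₀ * (C : Set G)) =
      (fun x => g * x) ⁻¹' (U₀ * (C : Set G)) := by
    ext x
    constructor
    · intro hx
      have := hconj g _ hx
      simpa [mul_assoc] using this
    · intro hx
      have := hconj g⁻¹ _ hx
      simpa [mul_assoc] using this
  have hfac := Measure.isMulLeftInvariant_eq_smul (Measure.map (fun x => x * g) m) m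
  have heq : Measure.map (fun x => x * g) m (U₀ * (C : Set G)) = m (U₀ * (C : Set G)) := by
    rw [(MeasurableEquiv.mulRight g).measurableEmbedding.map_apply
      (f := fun x => x * g), hpre, measure_preimage_mul]
  rw [hfac, Measure.smul_apply] at heq
  have h0 : m (U₀ * (C : Set G)) ≠ 0 := (Measure.measure_pos_of_mem_nhds m hUn).ne'
  have htop : m (U₀ * (C : Set G)) ≠ ⊤ := hU.measure_lt_top.ne
  have hc : Measure.haarScalarFactor (Measure.map (fun x => x * g) m) m = 1 := by
    rw [ENNReal.smul_def, smul_eq_mul] at heq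
    have h3 := (ENNReal.mul_eq_right h0 htop).1 heq
    exact_mod_cast h3
  rw [hfac, hc, one_smul]

theorem exists_isNilpotent_of_commutator_le_center {G : Type*} [Group G]
    (h : commutator G ≤ Subgroup.center G) :
    ∃ _ : Group.IsNilpotent G, Group.nilpotencyClass G ≤ 2 := by
  have hb : (⊤ : Subgroup G).lowerCentralSeries 2 = ⊥ := by
    rw [Subgroup.lowerCentralSeries_succ, Subgroup.top_lowerCentralSeries_one,
      Subgroup.commutator_eq_bot_iff_le_centralizer]
    exact h.trans (Subgroup.center_le_centralizer _)
  have hn : Group.IsNilpotent G := Subgroup.nilpotent_iff_lowerCentralSeries.2 ⟨2, hb⟩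
  exact ⟨hn, Subgroup.lowerCentralSeries_eq_bot_iff_nilpotencyClass_le.1 hb⟩

theorem isOpenMap_of_image_ball_mem_nhds {G Z : Type*} [Group G] [MetricSpace G]
    [NormedAddCommGroup Z] (hinv : ∀ a b c : G, dist (a * c) (b * c) = dist a b)
    (f : G → Z) (hmul : ∀ a b, f (a * b) = f a + f b)
    (hf : ∀ r > 0, f '' Metric.ball 1 r ∈ 𝓝 (0 : Z)) : IsOpenMap f := by
  refine IsOpenMap.of_nhds_le fun x => ?_
  intro s hs
  rw [mem_map] at hs
  obtain ⟨r, hr, hrs⟩ := Metric.mem_nhds_iff.1 hs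
  have hT : Tendsto (fun z => z - f x) (𝓝 (f x)) (𝓝 0) := by
    have : Continuous fun z : Z => z - f x := by fun_prop
    simpa using this.tendsto (f x)
  filter_upwards [hT (hf r hr)] with z hz
  obtain ⟨g, hg, hgz⟩ := hz
  have : z = f (g * x) := by rw [hmul, hgz]; exact (sub_add_cancel _ _).symm
  rw [this]
  refine hrs ?_
  have h1 := hinv g 1 x
  rw [one_mul] at h1
  rw [Metric.mem_ball, h1]
  exact hg

end General

section HostKra
variable {Z : Type*} [NormedAddCommGroup Z] [CompactSpace Z] [MeasurableSpace Z] [BorelSpace Z]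
  {μ : Measure Z} [μ.IsAddLeftInvariant] [IsProbabilityMeasure μ]
  {K : Type*} [NormedAddCommGroup K] [CompactSpace K] {Γ : Type*} [AddCommGroup Γ]
  {φ : Γ →+ Z} {R : Γ → Lp K 1 μ}

theorem memLp_of_continuous {f : Z → K} (hf : Continuous f) : MemLp f 1 μ := by
  obtain ⟨C, hC⟩ := (isCompact_univ (X := K)).isBounded.exists_norm_le
  have : SecondCountableTopology Z := UniformSpace.secondCountable_of_separable Z
  exact MemLp.of_bound hf.aestronglyMeasurable C (Eventually.of_forall fun x => hC _ (mem_univ _))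

variable (herg : ∀ F : Lp K 1 μ, (∀ γ, translate (φ γ) F = F) →
  F ∈ (Lp.const 1 μ : K →+ Lp K 1 μ).range)

include herg in
/-- An element `F` of the kernel of the projection to `Z` is an eigenfunction for all translations:
`F(z + ·) - F` is invariant under `φ(Γ)`, hence constant. -/
theorem exists_character {F : Lp K 1 μ}
    (hF : ∀ γ, translate (φ γ) F - F ∈ (Lp.const 1 μ : K →+ Lp K 1 μ).range) :
    ∃ χ : Z →+ K, Continuous χ ∧ ∀ z, translate z F = F + Lp.const 1 μ (χ z) := by
  have h1 : ∀ z, ∃ k, Lp.const 1 μ k = translate z F - F := by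
    intro z
    refine herg _ fun γ => ?_
    obtain ⟨c, hc⟩ := hF γ
    have : translate (φ γ) F = F + Lp.const 1 μ c := by rw [hc]; abel
    rw [map_sub, translate_comm, this, map_add, translate_const]
    abel
  choose χ hχ using h1
  have h2 : ∀ z, translate z F = F + Lp.const 1 μ (χ z) := fun z => by rw [hχ]; abel
  have inj := (isometry_Lp_const (μ := μ) (K := K)).injective
  refine ⟨AddMonoidHom.mk' χ fun a b => inj ?_, ?_, h2⟩
  · rw [map_add, hχ, translate_add, h2 b, map_add, translate_const, h2 a]
    abel
  · refine (isometry_Lp_const (μ := μ) (K := K)).isEmbedding.continuous_iff.2 ?_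
    have : (Lp.const 1 μ : K → Lp K 1 μ) ∘ χ = fun z => translate z F - F := funext hχ
    exact this ▸ (continuous_id.lpTranslate continuous_const).sub continuous_const

include herg in
theorem exists_continuousMap_ae_eq {F : Lp K 1 μ}
    (hF : ∀ γ, translate (φ γ) F - F ∈ (Lp.const 1 μ : K →+ Lp K 1 μ).range) :
    ∃ f : C(Z, K), F =ᵐ[μ] f := by
  obtain ⟨χ, hχ, h⟩ := exists_character herg hF
  have hm : MemLp χ 1 μ := memLp_of_continuous hχ
  have h1 : ∀ z, translate z (hm.toLp χ) = hm.toLp χ + Lp.const 1 μ (χ z) := by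
    intro z
    refine Lp.ext ?_
    have e1 := (measurePreserving_add_left μ z).quasiMeasurePreserving.ae hm.coeFn_toLp
    filter_upwards [coeFn_translate z (hm.toLp χ), e1, hm.coeFn_toLp,
      Lp.coeFn_const (p := 1) (μ := μ) (χ z), Lp.coeFn_add (hm.toLp χ) (Lp.const 1 μ (χ z))]
      with x h1 h2 h3 h4 h5
    rw [h1, h2, h5, Pi.add_apply, h3, h4, map_add, add_comm]; rfl
  obtain ⟨k, hk⟩ := herg (F - hm.toLp χ) fun γ => by
    rw [map_sub, h, h1]; abel
  refine ⟨⟨fun x => χ x + k, by fun_prop⟩, ?_⟩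
  have : F = hm.toLp χ + Lp.const 1 μ k := by rw [hk]; abel
  rw [this]
  filter_upwards [hm.coeFn_toLp,
      Lp.coeFn_const (p := 1) (μ := μ) k, Lp.coeFn_add (hm.toLp χ) (Lp.const 1 μ k)]
      with x h3 h4 h5
  rw [h5, Pi.add_apply, h3, h4]; rfl

variable (hU : ∃ U ∈ 𝓝 (0 : K), ∀ H : AddSubgroup K, (H : Set K) ⊆ U → H = ⊥)

include herg hU in
/-- The constants are open in the kernel of the projection to `Z`: the character of an element `F` of
the kernel satisfies `‖χ z‖ = ‖F(z + ·) - F‖ ≤ 2 ‖F‖`. -/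
theorem exists_forall_norm_lt_mem_range_const :
    ∃ ε > 0, ∀ F : Lp K 1 μ,
      (∀ γ, translate (φ γ) F - F ∈ (Lp.const 1 μ : K →+ Lp K 1 μ).range) → ‖F‖ < ε →
      F ∈ (Lp.const 1 μ : K →+ Lp K 1 μ).range := by
  obtain ⟨U, hU0, hU⟩ := hU
  obtain ⟨r, hr, hrU⟩ := Metric.mem_nhds_iff.1 hU0
  refine ⟨r / 2, by positivity, fun F hF hFr => ?_⟩
  obtain ⟨χ, -, h⟩ := exists_character herg hF
  have hbot : χ.range = ⊥ := by
    refine hU _ fun k hk => hrU ?_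
    obtain ⟨z, rfl⟩ := hk
    rw [mem_ball_zero_iff, ← norm_Lp_const (μ := μ)]
    have : Lp.const 1 μ (χ z) = translate z F - F := by rw [h]; abel
    rw [this]
    have h2 := norm_sub_le (translate z F) F
    rw [norm_translate] at h2
    linarith
  refine herg F fun γ => ?_
  have : χ (φ γ) = 0 := by
    have : χ (φ γ) ∈ χ.range := ⟨_, rfl⟩
    rwa [hbot, AddSubgroup.mem_bot] at this
  rw [h, this, map_zero, add_zero]

theorem translate_sub_mem_of_fst_eq_zero (g : hostKra φ R) (hg : g.1.1 = 0) (γ : Γ) :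
    translate (φ γ) g.1.2 - g.1.2 ∈ (Lp.const 1 μ : K →+ Lp K 1 μ).range := by
  have := g.2 γ
  rw [hg, translate_zero, sub_self, zero_sub] at this
  simpa using neg_mem this

theorem hostKra_dist_mul_right (a b c : hostKra φ R) : dist (a * c) (b * c) = dist a b :=
  SkewGroup.dist_mul_right _ _ _

theorem norm_snd_le_dist_one (g : hostKra φ R) : ‖g.1.2‖ ≤ dist g 1 := by
  rw [← dist_zero_right]
  exact le_max_right (dist g.1.1 0) (dist g.1.2 0)

theorem hostKraConst_mul_comm (k : K) (g : hostKra φ R) :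
    hostKraConst φ R k * g = g * hostKraConst φ R k := by
  refine Subtype.ext (SkewGroup.ext ?_ ?_)
  · simp [hostKraConst]
  · simp [hostKraConst, translate_zero, translate_const, add_comm]

theorem hostKraConst_add (k l : K) :
    hostKraConst φ R (k + l) = hostKraConst φ R k * hostKraConst φ R l := by
  refine Subtype.ext (SkewGroup.ext ?_ ?_)
  · simp [hostKraConst]
  · simp [hostKraConst, translate_zero]

theorem isometry_hostKraConst : Isometry (hostKraConst φ R) := by
  refine Isometry.of_dist_eq fun k l => ?_
  rw [Subtype.dist_eq, SkewGroup.dist_eq]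
  simp [hostKraConst, isometry_Lp_const.dist_eq]

instance : CompleteSpace (hostKra φ R) := isClosed_hostKra.completeSpace_coe

theorem hostKra_fst_mul (g h : hostKra φ R) : (g * h).1.1 = g.1.1 + h.1.1 := rfl

theorem continuous_hostKra_fst : Continuous fun g : hostKra φ R => g.1.1 :=
  SkewGroup.continuous_fst.comp continuous_subtype_val

variable (hCL : ∀ z, ∃ g : hostKra φ R, g.1.1 = z)

include hCL in
theorem isOpenMap_hostKra_fst : IsOpenMap fun g : hostKra φ R => g.1.1 :=
  isOpenMap_of_image_ball_mem_nhds hostKra_dist_mul_right _ hostKra_fst_mul fun _ hr =>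
    mem_nhds_image_ball_of_rightInvariant hostKra_dist_mul_right _ hostKra_fst_mul
      continuous_hostKra_fst hCL hr

theorem mul_inv_fst_eq_zero {g h : hostKra φ R} (hgh : g.1.1 = h.1.1) : (g * h⁻¹).1.1 = 0 := by
  simp [hgh]

theorem exists_eq_hostKraConst {g : hostKra φ R} (hg : g.1.1 = 0)
    (hg' : g.1.2 ∈ (Lp.const 1 μ : K →+ Lp K 1 μ).range) : ∃ k, g = hostKraConst φ R k := by
  obtain ⟨k, hk⟩ := hg'
  exact ⟨k, Subtype.ext (SkewGroup.ext hg hk.symm)⟩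

include herg hU hCL in
/-- The closed ball `W` of radius `ε / 4` is totally bounded, where `ε` is such that elements of the
kernel within `ε` of `1` are constants. As `Z` is compact and the projection to it open, finitely many
`x z ∈ W` exist such that each `w ∈ W` has the projection of some `b * x z` with `b` close to `1`.
Then `w * (b * x z)⁻¹` is a constant, so `w` is close to one of the compact sets
`G₂ * x z`. -/
theorem locallyCompactSpace_hostKra : LocallyCompactSpace (hostKra φ R) := by
  obtain ⟨ε, hε, hsmall⟩ := exists_forall_norm_lt_mem_range_const herg hU
  have hopen := isOpenMap_hostKra_fst hCL
  let W : Set (hostKra φ R) := Metric.closedBall 1 (ε / 4)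
  suffices hW : IsCompact W from
    hW.locallyCompactSpace_of_mem_nhds_of_group (Metric.closedBall_mem_nhds 1 (by positivity))
  refine TotallyBounded.isCompact_of_isClosed ?_ Metric.isClosed_closedBall
  rw [Metric.totallyBounded_iff]
  intro η hη
  set η' := min (η / 2) (ε / 4)
  have hη' : 0 < η' := by positivity
  obtain ⟨δ, hδ, hδη⟩ := Metric.mem_nhds_iff.1
    (hopen.image_mem_nhds (Metric.ball_mem_nhds (1 : hostKra φ R) hη'))
  obtain ⟨t, htW, htf, hcov⟩ := Metric.finite_approx_of_totallyBounded
    (isCompact_univ.totallyBounded.subset (subset_univ ((fun g : hostKra φ R => g.1.1) '' W))) δ hδ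
  have htW' : ∀ z ∈ t, ∃ x ∈ W, x.1.1 = z := fun z hz => htW hz
  choose! x hxW hx using htW'
  have hFc : IsCompact (⋃ z ∈ t, (fun k => hostKraConst φ R k * x z) '' univ) :=
    htf.isCompact_biUnion fun z _ => isCompact_univ.image
      (isometry_hostKraConst.continuous.mul continuous_const)
  obtain ⟨s, hs, hsc⟩ := Metric.totallyBounded_iff.1 hFc.totallyBounded (η / 2) (by positivity)
  refine ⟨s, hs, fun w hw => ?_⟩
  obtain ⟨z, hz, hzw⟩ := mem_iUnion₂.1 (hcov ⟨w, hw, rfl⟩)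
  have hdz : w.1.1 - z ∈ Metric.ball ((1 : hostKra φ R).1.1) δ := by
    rw [Metric.mem_ball, dist_eq_norm] at hzw
    simpa using hzw
  obtain ⟨b, hb, hbz⟩ := hδη hdz
  simp only at hbz
  rw [Metric.mem_ball] at hb
  have hfst : w.1.1 = (b * x z).1.1 := by
    rw [hostKra_fst_mul, hbz, hx z hz]; abel
  have hbx : dist (b * x z) (x z) = dist b 1 := by
    have := hostKra_dist_mul_right b 1 (x z)
    rwa [one_mul] at this
  have hda : dist (w * (b * x z)⁻¹) 1 < ε := by
    have h1 := hostKra_dist_mul_right w (b * x z) (b * x z)⁻¹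
    rw [mul_inv_cancel] at h1
    rw [h1]
    have h2 := dist_triangle4_right w 1 (b * x z) (x z)
    have h3 : dist w 1 ≤ ε / 4 := hw
    have h4 : dist (x z) 1 ≤ ε / 4 := hxW z hz
    have h5 : η' ≤ ε / 4 := min_le_right _ _
    have := dist_triangle w 1 (b * x z)
    have := dist_triangle_right 1 (b * x z) (x z)
    rw [dist_comm 1 (x z)] at this
    linarith
  obtain ⟨k, hk⟩ := exists_eq_hostKraConst (mul_inv_fst_eq_zero hfst)
    (hsmall _ (translate_sub_mem_of_fst_eq_zero _ (mul_inv_fst_eq_zero hfst))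
      (lt_of_le_of_lt (norm_snd_le_dist_one _) hda))
  have hw' : w = b * (hostKraConst φ R k * x z) := by
    rw [← mul_assoc, ← hostKraConst_mul_comm, mul_assoc, ← hk, inv_mul_cancel_right]
  obtain ⟨y, hy, hyd⟩ := mem_iUnion₂.1
    (hsc (mem_iUnion₂.2 ⟨z, hz, mem_image_of_mem _ (mem_univ k)⟩))
  refine mem_iUnion₂.2 ⟨y, hy, ?_⟩
  rw [Metric.mem_ball] at hyd ⊢
  have h6 : dist w (hostKraConst φ R k * x z) = dist b 1 := by
    have := hostKra_dist_mul_right b 1 (hostKraConst φ R k * x z)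
    rwa [one_mul, ← hw'] at this
  have h7 := dist_triangle w (hostKraConst φ R k * x z) y
  have h8 : η' ≤ η / 2 := min_le_left _ _
  linarith

/-- The central subgroup of vertical translations, the group `G₂` of the construction; it is a copy
of `K`, and may be smaller than the centre of the Host--Kra group. -/
noncomputable def hostKraCenter (φ : Γ →+ Z) (R : Γ → Lp K 1 μ) : Subgroup (hostKra φ R) where
  carrier := range (hostKraConst φ R)
  one_mem' := ⟨0, Subtype.ext (SkewGroup.ext rfl (by simp [hostKraConst]))⟩
  mul_mem' := by
    rintro _ _ ⟨k, rfl⟩ ⟨l, rfl⟩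
    exact ⟨k + l, hostKraConst_add k l⟩
  inv_mem' := by
    rintro _ ⟨k, rfl⟩
    refine ⟨-k, Subtype.ext (SkewGroup.ext ?_ ?_)⟩
    · simp [hostKraConst]
    · simp [hostKraConst, translate_zero]

theorem isCompact_hostKraCenter : IsCompact (hostKraCenter φ R : Set (hostKra φ R)) :=
  isCompact_range isometry_hostKraConst.continuous

theorem hostKraCenter_le_center : hostKraCenter φ R ≤ Subgroup.center (hostKra φ R) := by
  rintro _ ⟨k, rfl⟩
  rw [Subgroup.mem_center_iff]
  exact fun g => (hostKraConst_mul_comm k g).symm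

theorem isRealLieGroup_hostKraCenter (hK : IsRealLieAddGroup K) :
    IsRealLieGroup (hostKraCenter φ R) := by
  let e : K ≃ₜ hostKraCenter φ R :=
    (isometry_hostKraConst (φ := φ) (R := R)).isEmbedding.toHomeomorph
  have h : ∀ c, hostKraConst φ R (e.symm c) = c := fun c =>
    congrArg Subtype.val (e.apply_symm_apply c)
  refine hK.isRealLieGroup_of_homeomorph e.symm fun a b => ?_
  refine (isometry_hostKraConst (φ := φ) (R := R)).injective ?_
  rw [h, hostKraConst_add, h, h]
  rfl

include herg in
/-- For `g = (z, F)` and `h = (z', F')`, the products `g h` and `h g` differ by the function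
`(F(z' + ·) - F) - (F'(z + ·) - F')`. The equations for `g` and `h` show that it is invariant under
`φ(Γ)`: the contributions of `R γ` are the same mixed second difference of `R γ`. -/
theorem commutator_hostKra_le : commutator (hostKra φ R) ≤ hostKraCenter φ R := by
  rw [commutator_def, Subgroup.commutator_le]
  intro g _ h _
  have hfst : (g * h).1.1 = (h * g).1.1 := by
    rw [hostKra_fst_mul, hostKra_fst_mul, add_comm]
  have key : ∀ γ, translate (φ γ) ((g * h).1.2 - (h * g).1.2) = (g * h).1.2 - (h * g).1.2 := by
    intro γ
    obtain ⟨c, hc⟩ := g.2 γ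
    obtain ⟨d, hd⟩ := h.2 γ
    have hg' : translate (φ γ) g.1.2 =
        g.1.2 + (translate g.1.1 (R γ) - R γ) - Lp.const 1 μ c := by rw [hc]; abel
    have hh' : translate (φ γ) h.1.2 =
        h.1.2 + (translate h.1.1 (R γ) - R γ) - Lp.const 1 μ d := by rw [hd]; abel
    change translate (φ γ) ((translate h.1.1 g.1.2 + h.1.2) - (translate g.1.1 h.1.2 + g.1.2)) =
      (translate h.1.1 g.1.2 + h.1.2) - (translate g.1.1 h.1.2 + g.1.2)
    simp only [map_add, map_sub, translate_comm (φ γ), hg', hh', translate_const]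
    rw [translate_comm h.1.1 g.1.1]
    abel
  obtain ⟨k, hk⟩ := herg _ key
  have : ⁅g, h⁆ = g * h * (h * g)⁻¹ := by rw [commutatorElement_def]; group
  rw [this]
  have h2 : g * h = hostKraConst φ R k * (h * g) := by
    refine Subtype.ext (SkewGroup.ext ?_ ?_)
    · simp [hostKraConst, add_comm]
    · change (g * h).1.2 = translate (h * g).1.1 (Lp.const 1 μ k) + (h * g).1.2
      rw [translate_const, hk]; abel
  rw [h2, mul_inv_cancel_right]
  exact ⟨k, rfl⟩

end HostKra

/-! ### The lattice -/

section HostKra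
variable {Z : Type*} [NormedAddCommGroup Z] [CompactSpace Z] [MeasurableSpace Z] [BorelSpace Z]
  {μ : Measure Z} [μ.IsAddLeftInvariant] [IsProbabilityMeasure μ] [μ.IsOpenPosMeasure]
  {K : Type*} [NormedAddCommGroup K] [CompactSpace K] {Γ : Type*} [AddCommGroup Γ]
  {φ : Γ →+ Z} {R : Γ → Lp K 1 μ}

theorem eq_of_Lp_const_ae_eq {k : K} {f : C(Z, K)} (h : Lp.const 1 μ k =ᵐ[μ] f) (x : Z) :
    f x = k := by
  have h1 : f =ᵐ[μ] fun _ => k := h.symm.trans (Lp.coeFn_const (p := 1) (μ := μ) k)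
  exact congrFun ((Continuous.ae_eq_iff_eq μ f.continuous continuous_const).1 h1) x

/-- The subgroup of all `(0, F)` in the Host--Kra group such that `F` has a continuous version that
vanishes at `z₀`. It stands for the stabiliser of the point `(z₀, 0)` of `Z × K`. -/
noncomputable def hostKraLattice (φ : Γ →+ Z) (R : Γ → Lp K 1 μ) (z₀ : Z) :
    Subgroup (hostKra φ R) where
  carrier := {g | g.1.1 = 0 ∧ ∃ f : C(Z, K), g.1.2 =ᵐ[μ] f ∧ f z₀ = 0}
  one_mem' := ⟨rfl, 0, Lp.coeFn_zero _ _ _, rfl⟩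
  mul_mem' := by
    rintro g h ⟨hg, f, hf, hf0⟩ ⟨hh, f', hf', hf0'⟩
    refine ⟨by rw [hostKra_fst_mul, hg, hh, add_zero], f + f', ?_, by simp [hf0, hf0']⟩
    have : (g * h).1.2 = g.1.2 + h.1.2 := by
      change translate h.1.1 g.1.2 + h.1.2 = _
      rw [hh, translate_zero]
    rw [this]
    exact (Lp.coeFn_add _ _).trans (hf.add hf')
  inv_mem' := by
    rintro g ⟨hg, f, hf, hf0⟩
    refine ⟨by simp [hg], -f, ?_, by simp [hf0]⟩
    have : (g⁻¹).1.2 = -g.1.2 := by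
      change -translate (-g.1.1) g.1.2 = _
      rw [hg, neg_zero, translate_zero]
    rw [this]
    exact (Lp.coeFn_neg _).trans hf.neg

variable {z₀ : Z}

theorem hostKraLattice_fst {g : hostKra φ R} (hg : g ∈ hostKraLattice φ R z₀) : g.1.1 = 0 := hg.1

theorem eq_zero_of_hostKraConst_mem {k : K}
    (h : hostKraConst φ R k ∈ hostKraLattice φ R z₀) : k = 0 := by
  obtain ⟨-, f, hf, hf0⟩ := h
  rw [← eq_of_Lp_const_ae_eq hf z₀, hf0]

theorem hostKraLattice_inf_center : hostKraLattice φ R z₀ ⊓ hostKraCenter φ R = ⊥ := by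
  rw [eq_bot_iff]
  rintro _ ⟨h, k, rfl⟩
  rw [eq_zero_of_hostKraConst_mem h]
  exact (hostKraCenter φ R).one_mem.elim fun l hl => by
    rw [Subgroup.mem_bot]
    refine Subtype.ext (SkewGroup.ext rfl ?_)
    simp [hostKraConst]

theorem hostKraLattice_comm {a b : hostKra φ R} (ha : a ∈ hostKraLattice φ R z₀)
    (hb : b ∈ hostKraLattice φ R z₀) : a * b = b * a := by
  refine Subtype.ext (SkewGroup.ext (add_comm _ _) ?_)
  change translate b.1.1 a.1.2 + b.1.2 = translate a.1.1 b.1.2 + a.1.2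
  rw [ha.1, hb.1, translate_zero, translate_zero, add_comm]

variable (herg : ∀ F : Lp K 1 μ, (∀ γ, translate (φ γ) F = F) →
  F ∈ (Lp.const 1 μ : K →+ Lp K 1 μ).range)
  (hU : ∃ U ∈ 𝓝 (0 : K), ∀ H : AddSubgroup K, (H : Set K) ⊆ U → H = ⊥)
  (hCL : ∀ z, ∃ g : hostKra φ R, g.1.1 = z)

include herg hU in
theorem discreteTopology_hostKraLattice : DiscreteTopology (hostKraLattice φ R z₀) := by
  obtain ⟨ε, hε, hsmall⟩ := exists_forall_norm_lt_mem_range_const herg hU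
  refine DiscreteTopology.of_forall_le_dist hε fun a b hab => ?_
  by_contra! hlt
  refine hab ?_
  have hmem : (a : hostKra φ R) * (b : hostKra φ R)⁻¹ ∈ hostKraLattice φ R z₀ :=
    (a * b⁻¹).2
  have hd : dist ((a : hostKra φ R) * (b : hostKra φ R)⁻¹) 1 < ε := by
    have := hostKra_dist_mul_right (a : hostKra φ R) b (b : hostKra φ R)⁻¹
    rw [mul_inv_cancel] at this
    rw [this]
    exact hlt
  obtain ⟨k, hk⟩ := exists_eq_hostKraConst hmem.1
    (hsmall _ (translate_sub_mem_of_fst_eq_zero _ hmem.1)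
      (lt_of_le_of_lt (norm_snd_le_dist_one _) hd))
  have h1 : (a : hostKra φ R) * (b : hostKra φ R)⁻¹ ∈ hostKraLattice φ R z₀ ⊓ hostKraCenter φ R :=
    ⟨hmem, k, hk.symm⟩
  rw [hostKraLattice_inf_center, Subgroup.mem_bot, mul_inv_eq_one] at h1
  exact Subtype.ext h1

/-- Elements over `0` are products of a constant, the value at `z₀` of the continuous version, and of
an element of the lattice. -/
theorem const_mul_mem_hostKraLattice {g : hostKra φ R} (hg : g.1.1 = 0) {f : C(Z, K)}
    (hf : g.1.2 =ᵐ[μ] f) : hostKraConst φ R (-f z₀) * g ∈ hostKraLattice φ R z₀ := by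
  refine ⟨by simp [hostKraConst, hg], f + .const Z (-f z₀), ?_, by simp⟩
  have : (hostKraConst φ R (-f z₀) * g).1.2 = g.1.2 + Lp.const 1 μ (-f z₀) := by
    change translate g.1.1 (Lp.const 1 μ (-f z₀)) + g.1.2 = _
    rw [translate_const, add_comm]
  rw [this]
  exact (Lp.coeFn_add _ _).trans (hf.add (Lp.coeFn_const (p := 1) (μ := μ) _))

include herg hU hCL in
/-- Finitely many translates of a compact neighbourhood of `1` cover `Z` under the projection;
multiplied by the compact group of constants, they cover the quotient by the lattice. -/
theorem compactSpace_hostKra_quotient : CompactSpace (hostKra φ R ⧸ hostKraLattice φ R z₀) := by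
  have := locallyCompactSpace_hostKra herg hU hCL
  obtain ⟨W, hW, hW1⟩ := exists_compact_mem_nhds (1 : hostKra φ R)
  choose s hs using hCL
  have hopen := isOpenMap_hostKra_fst (φ := φ) (R := R) fun z => ⟨s z, hs z⟩
  have hn : ∀ z : Z, (fun g : hostKra φ R => g.1.1) '' ((fun g => g * s z) '' W) ∈ 𝓝 z := by
    intro z
    have h1 : (fun g => g * s z) '' W ∈ 𝓝 (s z) := by
      have := (Homeomorph.mulRight (s z)).isOpenMap.image_mem_nhds hW1
      simpa using this
    have := hopen.image_mem_nhds h1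
    rwa [hs] at this
  obtain ⟨t, -, ht⟩ := isCompact_univ.elim_nhds_subcover _ fun z _ => hn z
  let Q : Set (hostKra φ R) := (⋃ z ∈ t, (fun g => g * s z) '' W) * range (hostKraConst φ R)
  have hQ : IsCompact Q :=
    (t.isCompact_biUnion fun z _ => hW.image (continuous_mul_const (s z))).mul
      (isCompact_range isometry_hostKraConst.continuous)
  refine ⟨(hQ.image (QuotientGroup.continuous_mk (N := hostKraLattice φ R z₀))).of_isClosed_subset
    isClosed_univ fun x _ => ?_⟩
  obtain ⟨g, rfl⟩ := QuotientGroup.mk_surjective x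
  obtain ⟨z, hz, a, ha, hag⟩ := mem_iUnion₂.1 (ht (mem_univ g.1.1))
  have h0 : (a⁻¹ * g).1.1 = 0 := by
    rw [hostKra_fst_mul, ← hag]
    exact neg_add_cancel a.1.1
  obtain ⟨f, hf⟩ := exists_continuousMap_ae_eq herg (translate_sub_mem_of_fst_eq_zero _ h0)
  refine ⟨a * hostKraConst φ R (f z₀), ⟨a, mem_iUnion₂.2 ⟨z, hz, ha⟩, _, ⟨_, rfl⟩, rfl⟩, ?_⟩
  rw [QuotientGroup.eq]
  have h1 := const_mul_mem_hostKraLattice (z₀ := z₀) h0 hf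
  have h2 : (hostKraConst φ R (f z₀))⁻¹ = hostKraConst φ R (-f z₀) := by
    rw [inv_eq_iff_mul_eq_one, ← hostKraConst_add, add_neg_cancel]
    exact Subtype.ext (SkewGroup.ext rfl (by simp [hostKraConst]))
  rw [mul_inv_rev, h2, mul_assoc]
  exact h1

end HostKra

/-! ### Isomorphisms of systems, invariant measures and joint measurability -/

/-- A measure-preserving Borel isomorphism that intertwines two near-actions almost everywhere induces
an abstract isomorphism. -/
theorem abstractlyIsomorphic_of_measurableEquiv {Γ X Y : Type*} [AddCommGroup Γ]
    [MeasurableSpace X] [MeasurableSpace Y] {μ : Measure X} {ν : Measure Y}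
    (T : NearAction Γ μ) (S : NearAction Γ ν) (e : X ≃ᵐ Y) (he : MeasurePreserving e μ ν)
    (heq : ∀ γ, ∀ᵐ x ∂μ, e (T.act γ x) = S.act γ (e x)) : AbstractlyIsomorphic T S := by
  have he' : MeasurePreserving e.symm ν μ := he.symm e
  refine ⟨{ pullback := ⟨⟨ProbAlg.comap e he, ProbAlg.comap e.symm he', ?_, ?_⟩, ?_⟩
            measure_pullback := ?_, equivariant := ?_ }⟩
  · intro E
    induction E using Quotient.inductionOn with | _ s
    exact congrArg (Quotient.mk _) (Subtype.ext (by ext; simp))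
  · intro E
    induction E using Quotient.inductionOn with | _ s
    exact congrArg (Quotient.mk _) (Subtype.ext (by ext; simp))
  · intro E F
    induction E using Quotient.inductionOn with | _ s
    induction F using Quotient.inductionOn with | _ t
    constructor
    · intro h
      have h2 := he'.quasiMeasurePreserving.ae h
      refine h2.mono fun y hy => ?_
      have hy' : e (e.symm y) ∈ (s : Set Y) → e (e.symm y) ∈ (t : Set Y) := hy
      rwa [e.apply_symm_apply] at hy'
    · intro h
      exact he.quasiMeasurePreserving.ae h
  · intro E
    induction E using Quotient.inductionOn with | _ s
    exact he.measure_preimage s.2.nullMeasurableSet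
  · intro γ E
    induction E using Quotient.inductionOn with | _ s
    refine Quotient.sound ?_
    change e ⁻¹' (S.act γ ⁻¹' s) =ᵐ[μ] T.act γ ⁻¹' (e ⁻¹' s)
    filter_upwards [heq γ] with x hx
    have h : (S.act γ (e x) ∈ (s : Set Y)) = (e (T.act γ x) ∈ (s : Set Y)) := by rw [hx]
    exact h

/-- If `G` acts on `Z × K`, seen through the Borel isomorphism `e`, by skew translations, then it
preserves the product measure. The measurability of the fibre translation `l g` in `z` is automatic,
because `l g z` is a coordinate of `e⁻¹ (g • e (z, 0))`. -/
theorem smulInvariantMeasure_map_prod {G : Type*} {Z : Type*} {K : Type*} {Y : Type*} [Group G]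
    [MulAction G Y] [MeasurableSpace Y] [AddGroup Z] [MeasurableSpace Z] [MeasurableAdd Z]
    [AddCommGroup K] [MeasurableSpace K] [MeasurableAdd₂ K] (μ : Measure Z)
    [μ.IsAddLeftInvariant] [SFinite μ] (κ : Measure K) [κ.IsAddLeftInvariant] [SFinite κ]
    (e : Z × K ≃ᵐ Y) (hsm : ∀ g : G, Measurable fun y : Y => g • y) (π : G → Z)
    (h : ∀ g z, ∃ l, ∀ k, g • e (z, k) = e (π g + z, k + l)) :
    SMulInvariantMeasure G Y ((μ.prod κ).map e) := by
  choose l hl using h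
  have hlm : ∀ g, Measurable (l g) := by
    intro g
    have h1 : l g = fun z => (e.symm (g • e (z, 0))).2 := by
      funext z; rw [hl, e.symm_apply_apply, zero_add]
    rw [h1]
    exact measurable_snd.comp (e.symm.measurable.comp ((hsm g).comp
      (e.measurable.comp (measurable_id.prodMk measurable_const))))
  refine ⟨fun g s hs => ?_⟩
  have hmp : MeasurePreserving (fun p : Z × K => (π g + p.1, p.2 + l g p.1))
      (μ.prod κ) (μ.prod κ) := by
    refine (measurePreserving_add_left μ (π g)).skew_product
      (g := fun z k => k + l g z) ?_ ?_
    · exact measurable_snd.add ((hlm g).comp measurable_fst)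
    · exact Eventually.of_forall fun z => by
        simpa [add_comm] using map_add_left_eq_self κ (l g z)
  rw [Measure.map_apply e.measurable (hsm g hs), Measure.map_apply e.measurable hs,
    ← hmp.measure_preimage (e.measurable hs).nullMeasurableSet]
  congr 1
  ext p
  simp only [mem_preimage, ← hl]

theorem ae_tendsto_zero_of_norm_le {Z K : Type*} [MeasurableSpace Z] {μ : Measure Z}
    [NormedAddCommGroup K] {F : ℕ → Lp K 1 μ} (hF : ∀ n, ‖F n‖ ≤ (1 / 2) ^ n) :
    ∀ᵐ x ∂μ, Tendsto (fun n => F n x) atTop (𝓝 0) := by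
  have h1 : ∫⁻ x, ∑' n, ‖F n x‖ₑ ∂μ ≠ ⊤ := by
    rw [lintegral_tsum fun n => (Lp.aestronglyMeasurable (F n)).enorm]
    have h2 : ∀ n, ∫⁻ x, ‖F n x‖ₑ ∂μ ≤ (2⁻¹ : ENNReal) ^ n := by
      intro n
      rw [← eLpNorm_one_eq_lintegral_enorm, ← Lp.enorm_def, ← ofReal_norm]
      refine (ENNReal.ofReal_le_ofReal (hF n)).trans (le_of_eq ?_)
      rw [ENNReal.ofReal_pow (by norm_num), one_div, ENNReal.ofReal_inv_of_pos (by norm_num)]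
      simp
    refine ne_top_of_le_ne_top ?_ (ENNReal.tsum_le_tsum h2)
    rw [ENNReal.tsum_geometric]
    simp
  have hm : AEMeasurable (fun x => ∑' n, ‖F n x‖ₑ) μ :=
    AEMeasurable.tsum fun n => (Lp.aestronglyMeasurable (F n)).enorm
  filter_upwards [ae_lt_top' hm h1] with x hx
  have := ENNReal.tendsto_atTop_zero_of_tsum_ne_top hx.ne
  rw [tendsto_zero_iff_norm_tendsto_zero]
  have h3 := (ENNReal.tendsto_toReal ENNReal.zero_ne_top).comp this
  simpa [Function.comp_def] using h3

/-- A measurable family of function classes has a jointly measurable representative. It is the limit of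
families that take countably many values in `Lp K 1 μ` and converge fast enough to converge almost
everywhere. Measurability of `s` is expressed through distances, as `Lp K 1 μ` carries no σ-algebra. -/
theorem exists_measurable_uncurry_ae_eq {Y Z K : Type*} [MeasurableSpace Y] [MeasurableSpace Z]
    {μ : Measure Z} [NormedAddCommGroup K] [CompleteSpace K] [SecondCountableTopology K]
    [MeasurableSpace K] [BorelSpace K] [SecondCountableTopology (Lp K 1 μ)]
    {s : Y → Lp K 1 μ} (hs : ∀ F, Measurable fun y => dist (s y) F) :
    ∃ f : Y × Z → K, Measurable f ∧ ∀ y, s y =ᵐ[μ] fun x => f (y, x) := by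
  classical
  let D := TopologicalSpace.denseSeq (Lp K 1 μ)
  have hex : ∀ n : ℕ, ∀ y, ∃ j, dist (s y) (D j) < (1 / 2) ^ n := by
    intro n y
    obtain ⟨_, hn, ⟨j, rfl⟩⟩ := Metric.dense_iff.1
      (TopologicalSpace.denseRange_denseSeq (Lp K 1 μ)) (s y) ((1 / 2) ^ n) (by positivity)
    exact ⟨j, by rwa [dist_comm]⟩
  let j : ℕ → Y → ℕ := fun n y => Nat.find (hex n y)
  have hj : ∀ n, Measurable (j n) := fun n =>
    measurable_find (hex n) fun k => measurableSet_lt (hs (D k)) measurable_const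
  have hDm : Measurable fun p : ℕ × Z => D p.1 p.2 :=
    measurable_from_prod_countable_right fun k => (Lp.stronglyMeasurable (D k)).measurable
  let f : ℕ → Y × Z → K := fun n p => D (j n p.1) p.2
  have hf : ∀ n, StronglyMeasurable (f n) := fun n =>
    (hDm.comp (((hj n).comp measurable_fst).prodMk measurable_snd)).stronglyMeasurable
  refine ⟨fun p => limUnder atTop fun n => f n p, (StronglyMeasurable.limUnder hf).measurable,
    fun y => ?_⟩
  have hsub : ∀ n, ‖D (j n y) - s y‖ ≤ (1 / 2) ^ n := fun n => by
    rw [← dist_eq_norm, dist_comm]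
    exact (Nat.find_spec (hex n y)).le
  have hall : ∀ᵐ x ∂μ, ∀ n, (D (j n y) - s y : Lp K 1 μ) x = D (j n y) x - s y x :=
    ae_all_iff.2 fun n => Lp.coeFn_sub _ _
  filter_upwards [ae_tendsto_zero_of_norm_le hsub, hall] with x hx hx2
  simp only [hx2] at hx
  have : Tendsto (fun n => f n (y, x)) atTop (𝓝 (s y x)) := by
    have := hx.add_const (s y x)
    simpa [f] using this
  exact this.limUnder_eq.symm

/-! ### The normalized section and the isomorphism -/

section HostKra
variable {Z : Type*} [NormedAddCommGroup Z] [CompactSpace Z] [MeasurableSpace Z] [BorelSpace Z]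
  {μ : Measure Z} [μ.IsAddLeftInvariant] [IsProbabilityMeasure μ] [μ.IsOpenPosMeasure]
  {K : Type*} [NormedAddCommGroup K] [CompactSpace K] [MeasurableSpace K] [BorelSpace K]
  {Γ : Type*} [AddCommGroup Γ]
  {φ : Γ →+ Z} {R : Γ → Lp K 1 μ}

theorem memLp_of_measurable {f : Z → K} (hf : Measurable f) : MemLp f 1 μ := by
  obtain ⟨C, hC⟩ := (isCompact_univ (X := K)).isBounded.exists_norm_le
  have : SecondCountableTopology K := UniformSpace.secondCountable_of_separable K
  exact MemLp.of_bound hf.aestronglyMeasurable C (Eventually.of_forall fun x => hC _ (mem_univ _))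

/-- Ergodicity for functions with values in `K`, from ergodicity for sets: the preimages of Borel sets
under an invariant function are null or conull. -/
theorem mem_range_const_of_isErgodic (hZ : (rotationSystem μ φ).IsErgodic) (F : Lp K 1 μ)
    (hF : ∀ γ, translate (φ γ) F = F) : F ∈ (Lp.const 1 μ : K →+ Lp K 1 μ).range := by
  have : SecondCountableTopology K := UniformSpace.secondCountable_of_separable K
  have hFm : Measurable F := (Lp.stronglyMeasurable F).measurable
  have hsep : ∀ U : Set K, MeasurableSet U → (∀ᵐ x ∂μ, F x ∈ U) ∨ ∀ᵐ x ∂μ, F x ∉ U := by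
    intro U hUm
    have hinv : ∀ γ, (rotationSystem μ φ).pullback γ (ProbAlg.mk μ (F ⁻¹' U) (hFm hUm)) =
        ProbAlg.mk μ (F ⁻¹' U) (hFm hUm) := by
      intro γ
      refine Quotient.sound ?_
      change (fun x => φ γ + x) ⁻¹' (F ⁻¹' U) =ᵐ[μ] F ⁻¹' U
      have h := coeFn_translate (φ γ) F
      rw [hF] at h
      filter_upwards [h] with x hx
      have : (F (φ γ + x) ∈ U) = (F x ∈ U) := by rw [hx]
      exact this
    rcases hZ _ hinv with h | h
    · right
      have h' : F ⁻¹' U =ᵐ[μ] (∅ : Set Z) := Quotient.exact h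
      filter_upwards [h'] with x hx hxU
      have : x ∈ (∅ : Set Z) := (iff_of_eq hx).1 hxU
      exact this
    · left
      have h' : F ⁻¹' U =ᵐ[μ] (univ : Set Z) := Quotient.exact h
      filter_upwards [h'] with x hx
      exact (iff_of_eq hx).2 (mem_univ x)
  obtain ⟨k, hk⟩ := exists_eventuallyEq_const_of_forall_separating (l := ae μ) MeasurableSet hsep
  refine ⟨k, Lp.ext ?_⟩
  exact (Lp.coeFn_const (p := 1) (μ := μ) k).trans hk.symm

variable (herg : ∀ F : Lp K 1 μ, (∀ γ, translate (φ γ) F = F) →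
  F ∈ (Lp.const 1 μ : K →+ Lp K 1 μ).range)
  (hU : ∃ U ∈ 𝓝 (0 : K), ∀ H : AddSubgroup K, (H : Set K) ⊆ U → H = ⊥)
  (hCL : ∀ z, ∃ g : hostKra φ R, g.1.1 = z)

theorem hostKraConst_zero : hostKraConst φ R 0 = 1 :=
  Subtype.ext (SkewGroup.ext rfl (by simp [hostKraConst]))

theorem hostKraConst_neg (k : K) : hostKraConst φ R (-k) = (hostKraConst φ R k)⁻¹ := by
  rw [eq_inv_iff_mul_eq_one, ← hostKraConst_add, neg_add_cancel, hostKraConst_zero]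

include herg in
theorem exists_eq_hostKraConst_mul (z₀ : Z) {g : hostKra φ R} (hg : g.1.1 = 0) :
    ∃ k, ∃ a ∈ hostKraLattice φ R z₀, g = hostKraConst φ R k * a := by
  obtain ⟨f, hf⟩ := exists_continuousMap_ae_eq herg (translate_sub_mem_of_fst_eq_zero _ hg)
  refine ⟨f z₀, _, const_mul_mem_hostKraLattice (z₀ := z₀) hg hf, ?_⟩
  rw [hostKraConst_neg, mul_inv_cancel_left]

include herg hU in
/-- The continuous version of `F` depends continuously, in the uniform norm, on `(0, F)` in the
kernel; close to a given point, the versions differ by constants. -/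
theorem exists_continuous_representative :
    ∃ rep : {g : hostKra φ R // g.1.1 = 0} → C(Z, K), Continuous rep ∧
      ∀ g, g.1.1.2 =ᵐ[μ] rep g := by
  obtain ⟨ε, hε, hsmall⟩ := exists_forall_norm_lt_mem_range_const herg hU
  have hex : ∀ g : {g : hostKra φ R // g.1.1 = 0}, ∃ f : C(Z, K), g.1.1.2 =ᵐ[μ] f := fun g =>
    exists_continuousMap_ae_eq herg (translate_sub_mem_of_fst_eq_zero _ g.2)
  choose rep hrep using hex
  refine ⟨rep, Metric.continuous_iff.2 fun g η hη => ⟨min ε η, lt_min hε hη, fun h hh => ?_⟩, hrep⟩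
  have hd : ‖h.1.1.2 - g.1.1.2‖ < min ε η := by
    rw [← dist_eq_norm]
    exact lt_of_le_of_lt (le_max_right (dist h.1.1.1 g.1.1.1) _) hh
  obtain ⟨k, hk⟩ := hsmall (h.1.1.2 - g.1.1.2) (fun γ => by
    have := sub_mem (translate_sub_mem_of_fst_eq_zero _ h.2 γ)
      (translate_sub_mem_of_fst_eq_zero _ g.2 γ)
    rw [map_sub]
    convert this using 1
    abel) (hd.trans_le (min_le_left _ _))
  have hsub : Lp.const 1 μ k =ᵐ[μ] (rep h - rep g : C(Z, K)) := by
    rw [hk]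
    exact (Lp.coeFn_sub _ _).trans ((hrep h).sub (hrep g))
  rw [← hk, norm_Lp_const] at hd
  refine lt_of_le_of_lt ((ContinuousMap.dist_le (norm_nonneg k)).2 fun x => ?_)
    (hd.trans_le (min_le_right _ _))
  rw [dist_eq_norm, ← ContinuousMap.sub_apply, eq_of_Lp_const_ae_eq hsub]

include herg hU hCL in
/-- There are a point `z₀` and a Borel map `s` from `Z` to the Host--Kra group, where `s z` lies over
`z - z₀`, such that modulo the lattice at `z₀` left translation by `(φ γ, R γ)` sends `s z` to
`s (φ γ + z)` times the constant `r γ z`. Thus `s z` is an element that maps `(z₀, 0)` to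
`(z, 0)`. -/
theorem exists_normalized_section [Countable Γ] [MeasurableSpace (hostKra φ R)]
    [BorelSpace (hostKra φ R)]
    (hR : ∀ γ₁ γ₂, R (γ₁ + γ₂) = translate (φ γ₂) (R γ₁) + R γ₂)
    {r : Γ → Z → K} (hr : ∀ γ, Measurable (r γ)) (hRr : ∀ γ, R γ =ᵐ[μ] r γ) :
    ∃ (z₀ : Z) (s : Z → hostKra φ R), Measurable s ∧ (∀ z, (s z).1.1 = z - z₀) ∧
      ∀ γ, ∀ᵐ z ∂μ, ∃ a ∈ hostKraLattice φ R z₀,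
        hostKraHom hR (Multiplicative.ofAdd γ) * s z =
          s (φ γ + z) * hostKraConst φ R (r γ z) * a := by
  have : SecondCountableTopology Z := UniformSpace.secondCountable_of_separable Z
  have : SecondCountableTopology K := UniformSpace.secondCountable_of_separable K
  have : Fact ((1 : ENNReal) ≠ ⊤) := ⟨by simp⟩
  borelize C(Z, K)
  obtain ⟨s, hsm, hs⟩ := exists_measurable_rightInverse continuous_hostKra_fst
    (isOpenMap_hostKra_fst hCL) hCL
  obtain ⟨rep, hrepc, hrep⟩ := exists_continuous_representative (R := R) herg hU
  obtain ⟨f, hfm, hf⟩ := exists_measurable_uncurry_ae_eq (μ := μ) (s := fun z => (s z).1.2)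
    fun F => by
      have : Continuous fun g : hostKra φ R => dist g.1.2 F :=
        (SkewGroup.continuous_snd.comp continuous_subtype_val).dist continuous_const
      exact this.measurable.comp hsm
  let H : Γ → hostKra φ R := fun γ => hostKraHom hR (Multiplicative.ofAdd γ)
  -- `u γ z` compares `(φ γ, R γ) * s z` with `s (φ γ + z)`, which lie over the same point of `Z`.
  let u : Γ → Z → {g : hostKra φ R // g.1.1 = 0} := fun γ z =>
    ⟨(s (φ γ + z))⁻¹ * (H γ * s z), by
      change -(s (φ γ + z)).1.1 + (φ γ + (s z).1.1) = 0
      rw [hs, hs, neg_add_cancel]⟩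
  have hum : ∀ γ, Measurable (u γ) := fun γ =>
    (((hsm.comp (measurable_const_add (φ γ))).inv).mul (hsm.const_mul (H γ))).subtype_mk
  have hu : ∀ γ z, (u γ z).1.1.2 = translate z (R γ) + (s z).1.2 - (s (φ γ + z)).1.2 := by
    intro γ z
    change translate ((φ γ) + (s z).1.1) (-translate (-(s (φ γ + z)).1.1) (s (φ γ + z)).1.2) +
      (translate (s z).1.1 (R γ) + (s z).1.2) = _
    rw [hs, hs, map_neg, ← translate_add, add_neg_cancel, translate_zero]
    abel
  -- The relation holds for all `z` and almost every `x`. Both sides are jointly measurable, so that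
  -- Fubini's theorem lets the two quantifiers trade places.
  have key : ∀ γ, ∀ᵐ x ∂μ, ∀ᵐ z ∂μ,
      rep (u γ z) x = r γ (z + x) + f (z, x) - f (φ γ + z, x) := by
    intro γ
    have hE : Measurable fun p : Z × Z => rep (u γ p.1) p.2 := by
      have h1 : Continuous fun q : C(Z, K) × Z => q.1 q.2 := by fun_prop
      exact h1.measurable.comp
        ((hrepc.measurable.comp ((hum γ).comp measurable_fst)).prodMk measurable_snd)
    have hE' : Measurable fun p : Z × Z => r γ (p.1 + p.2) + f (p.1, p.2) - f (φ γ + p.1, p.2) :=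
      (((hr γ).comp (measurable_fst.add measurable_snd)).add hfm).sub
        (hfm.comp ((measurable_fst.const_add (φ γ)).prodMk measurable_snd))
    refine (Measure.ae_ae_comm
      (p := fun z x => rep (u γ z) x = r γ (z + x) + f (z, x) - f (φ γ + z, x))
      (measurableSet_eq_fun hE hE')).1 (Eventually.of_forall fun z => ?_)
    have h1 := (measurePreserving_add_left μ z).quasiMeasurePreserving.ae (hRr γ)
    have h2 := hrep (u γ z)
    rw [hu] at h2
    filter_upwards [h1, h2, coeFn_translate z (R γ), hf z, hf (φ γ + z),
      Lp.coeFn_sub (translate z (R γ) + (s z).1.2) (s (φ γ + z)).1.2,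
      Lp.coeFn_add (translate z (R γ)) (s z).1.2] with x h1 h2 h3 h4 h5 h6 h7
    rw [← h2, h6, Pi.sub_apply, h7, Pi.add_apply, h3, h4, h5, h1]
  obtain ⟨z₀, hz₀⟩ := (ae_all_iff.2 key).exists
  have hcont : Measurable (hostKraConst φ R) := isometry_hostKraConst.continuous.measurable
  -- The constant `-f (z - z₀, z₀)` makes the function component of the section vanish at `z₀`.
  refine ⟨z₀, fun z => s (z - z₀) * hostKraConst φ R (-f (z - z₀, z₀)), ?_, ?_, fun γ => ?_⟩
  · have hsub : Measurable fun z : Z => z - z₀ := measurable_id.sub_const z₀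
    exact (hsm.comp hsub).mul
      (hcont.comp (hfm.comp (hsub.prodMk measurable_const)).neg)
  · intro z
    rw [hostKra_fst_mul, hs]
    exact add_zero _
  · filter_upwards [(measurePreserving_sub_right μ z₀).quasiMeasurePreserving.ae (hz₀ γ)] with z hz
    rw [sub_add_cancel] at hz
    refine ⟨_, const_mul_mem_hostKraLattice (z₀ := z₀) (u γ (z - z₀)).2 (hrep _), ?_⟩
    have e1 : H γ * s (z - z₀) = s (φ γ + (z - z₀)) * (u γ (z - z₀)).1 :=
      (mul_inv_cancel_left _ _).symm
    change H γ * (s (z - z₀) * _) = _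
    rw [← mul_assoc, e1, add_sub_assoc, mul_assoc, ← hostKraConst_mul_comm]
    simp only [mul_assoc]
    rw [← mul_assoc (hostKraConst φ R (r γ z)), ← hostKraConst_add,
      ← mul_assoc (hostKraConst φ R _) (hostKraConst φ R _) (u γ _).1, ← hostKraConst_add, hz]
    congr 3
    abel

end HostKra

/-- The result for groups that are equipped with invariant metrics. -/
theorem exists_isGood_abstractlyIsomorphic {Γ : Type w} [AddCommGroup Γ] [Countable Γ]
    {Z : Type u} [NormedAddCommGroup Z] [CompactSpace Z] [MeasurableSpace Z] [BorelSpace Z]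
    (μ : Measure Z) [μ.IsAddHaarMeasure] [IsProbabilityMeasure μ]
    (φ : Γ →+ Z) (hZ : (rotationSystem μ φ).IsErgodic)
    {K : Type v} [NormedAddCommGroup K] [CompactSpace K] [MeasurableSpace K] [BorelSpace K]
    (hK : IsRealLieAddGroup K)
    (κ : Measure K) [κ.IsAddHaarMeasure] [IsProbabilityMeasure κ]
    [MeasurableAdd₂ K]
    (ρ : Cocycle (rotationSystem μ φ) K) (hCL : ρ.ConzeLesigne) :
    ∃ A : TranslationalSystem.{max u v, w} Γ,
      A.IsGood ∧ AbstractlyIsomorphic (ρ.extension κ) A.system := by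
  have : SecondCountableTopology Z := UniformSpace.secondCountable_of_separable Z
  have : SecondCountableTopology K := UniformSpace.secondCountable_of_separable K
  have hmem : ∀ γ, MemLp (ρ.toFun γ) 1 μ := fun γ => memLp_of_measurable (ρ.measurable γ)
  let R : Γ → Lp K 1 μ := fun γ => (hmem γ).toLp
  have hRr : ∀ γ, R γ =ᵐ[μ] ρ.toFun γ := fun γ => (hmem γ).coeFn_toLp
  have hR : ∀ γ₁ γ₂, R (γ₁ + γ₂) = translate (φ γ₂) (R γ₁) + R γ₂ := by
    intro γ₁ γ₂
    refine Lp.ext ?_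
    have h1 := (measurePreserving_add_left μ (φ γ₂)).quasiMeasurePreserving.ae (hRr γ₁)
    filter_upwards [hRr (γ₁ + γ₂), hRr γ₂, h1, coeFn_translate (φ γ₂) (R γ₁),
      Lp.coeFn_add (translate (φ γ₂) (R γ₁)) (R γ₂), ρ.cocycle_eq γ₁ γ₂] with x h1 h2 h3 h4 h5 h6
    rw [h1, h5, Pi.add_apply, h4, h3, h2, h6]
    rfl
  have herg : ∀ F : Lp K 1 μ, (∀ γ, translate (φ γ) F = F) →
      F ∈ (Lp.const 1 μ : K →+ Lp K 1 μ).range := mem_range_const_of_isErgodic hZ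
  have hU := hK.exists_nhds_no_small_subgroups
  have hCL' : ∀ z, ∃ g : hostKra φ R, g.1.1 = z := by
    intro z
    obtain ⟨F, hFm, c, hc⟩ := hCL z
    have hFmem : MemLp F 1 μ := memLp_of_measurable hFm
    refine ⟨⟨SkewGroup.mk z hFmem.toLp, fun γ => ⟨c γ, Lp.ext ?_⟩⟩, rfl⟩
    simp only [SkewGroup.mk_fst, SkewGroup.mk_snd]
    have h1 := (measurePreserving_add_left μ z).quasiMeasurePreserving.ae (hRr γ)
    have h2 := (measurePreserving_add_left μ (φ γ)).quasiMeasurePreserving.ae hFmem.coeFn_toLp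
    filter_upwards [hRr γ, h1, h2, hFmem.coeFn_toLp, coeFn_translate z (R γ),
      coeFn_translate (φ γ) hFmem.toLp, Lp.coeFn_const (p := 1) (μ := μ) (c γ),
      Lp.coeFn_sub (translate z (R γ)) (R γ), Lp.coeFn_sub (translate (φ γ) hFmem.toLp) hFmem.toLp,
      Lp.coeFn_sub (translate z (R γ) - R γ) (translate (φ γ) hFmem.toLp - hFmem.toLp), hc γ]
      with x h1 h2 h3 h4 h5 h6 h7 h8 h9 h10 h11
    rw [h10, Pi.sub_apply, h8, h9, Pi.sub_apply, Pi.sub_apply, h7, h5, h6, h1, h2, h3, h4, h11]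
    simp
  let mG : MeasurableSpace (hostKra φ R) := borel _
  have bG : BorelSpace (hostKra φ R) := ⟨rfl⟩
  obtain ⟨z₀, s, hsm, hs, hequiv⟩ := exists_normalized_section herg hU hCL' hR ρ.measurable hRr
  let L : Subgroup (hostKra φ R) := hostKraLattice φ R z₀
  have hdisc : DiscreteTopology L := discreteTopology_hostKraLattice herg hU
  have hclosed : IsClosed (L : Set (hostKra φ R)) := Subgroup.isClosed_of_discrete
  have hloc := locallyCompactSpace_hostKra herg hU hCL'
  have hcpt : CompactSpace (hostKra φ R ⧸ L) := compactSpace_hostKra_quotient herg hU hCL'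
  let mY : MeasurableSpace (hostKra φ R ⧸ L) := borel _
  have bY : BorelSpace (hostKra φ R ⧸ L) := ⟨rfl⟩
  let Φ : Z × K → hostKra φ R ⧸ L := fun p => QuotientGroup.mk (s p.1 * hostKraConst φ R p.2)
  have hΦm : Measurable Φ :=
    (QuotientGroup.continuous_mk (N := L)).measurable.comp
      ((hsm.comp measurable_fst).mul
        (isometry_hostKraConst.continuous.measurable.comp measurable_snd))
  have hΦi : Function.Injective Φ := by
    rintro ⟨z, k⟩ ⟨z', k'⟩ h
    have h1 := QuotientGroup.eq.1 h
    have h2 := hostKraLattice_fst h1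
    change -((s z).1.1 + 0) + ((s z').1.1 + 0) = 0 at h2
    rw [hs, hs, add_zero, add_zero, neg_add_eq_zero, sub_left_inj] at h2
    subst h2
    rw [mul_inv_rev, mul_assoc, inv_mul_cancel_left, ← hostKraConst_neg, ← hostKraConst_add] at h1
    have h3 := eq_zero_of_hostKraConst_mem h1
    exact congrArg (Prod.mk z) (neg_add_eq_zero.1 h3)
  -- On `Z × K`, every `g` acts as a skew translation.
  have hact : ∀ (g : hostKra φ R) (z : Z), ∃ l, ∀ k, g • Φ (z, k) = Φ (g.1.1 + z, k + l) := by
    intro g z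
    have h0 : ((s (g.1.1 + z))⁻¹ * (g * s z)).1.1 = 0 := by
      change -(s (g.1.1 + z)).1.1 + (g.1.1 + (s z).1.1) = 0
      rw [hs, hs]; abel
    obtain ⟨l, a, ha, hla⟩ := exists_eq_hostKraConst_mul herg z₀ h0
    refine ⟨l, fun k => ?_⟩
    rw [inv_mul_eq_iff_eq_mul] at hla
    change QuotientGroup.mk (g * (s z * hostKraConst φ R k)) = Φ _
    rw [← mul_assoc, hla, eq_comm, QuotientGroup.eq]
    have : (s (g.1.1 + z) * hostKraConst φ R (k + l))⁻¹ *
        (s (g.1.1 + z) * (hostKraConst φ R l * a) * hostKraConst φ R k) = a := by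
      rw [inv_mul_eq_iff_eq_mul, hostKraConst_add, hostKraConst_mul_comm k, mul_assoc, mul_assoc,
        ← hostKraConst_mul_comm k a, mul_assoc, mul_assoc]
    rw [this]
    exact ha
  have hΦs : Function.Surjective Φ := by
    intro x
    obtain ⟨g, rfl⟩ := QuotientGroup.mk_surjective x
    obtain ⟨l, hl⟩ := hact (g * (s 0)⁻¹) 0
    have h1 := hl 0
    refine ⟨_, h1.symm.trans ?_⟩
    change QuotientGroup.mk (g * (s 0)⁻¹ * (s 0 * hostKraConst φ R 0)) = _
    rw [hostKraConst_zero, mul_one, inv_mul_cancel_right]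
  have hΦe : MeasurableEmbedding Φ := hΦm.measurableEmbedding hΦi
  let e : Z × K ≃ᵐ hostKra φ R ⧸ L :=
    { Equiv.ofBijective Φ ⟨hΦi, hΦs⟩ with
      measurable_toFun := hΦm
      measurable_invFun := fun t ht => by
        rw [← (Equiv.ofBijective Φ ⟨hΦi, hΦs⟩).image_eq_preimage_symm]
        exact hΦe.measurableSet_image.2 ht }
  have hprob : IsProbabilityMeasure ((μ.prod κ).map e) :=
    Measure.isProbabilityMeasure_map e.measurable.aemeasurable
  have hinv : SMulInvariantMeasure (hostKra φ R) (hostKra φ R ⧸ L) ((μ.prod κ).map e) :=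
    smulInvariantMeasure_map_prod μ κ e
      (fun g => (continuous_const_smul g).measurable) (fun g => g.1.1) hact
  let A : TranslationalSystem.{max u v, w} Γ :=
    { G := hostKra φ R
      unimodular := fun m _ => isMulRightInvariant_of_commutator_le_compact m (hostKraCenter φ R)
        isCompact_hostKraCenter (commutator_hostKra_le herg)
      Λ := L
      isClosed := hclosed
      μ := (μ.prod κ).map e
      φ := hostKraHom hR }
  refine ⟨A, ⟨inferInstanceAs (PolishSpace (hostKra φ R)),
    exists_isNilpotent_of_commutator_le_center
      ((commutator_hostKra_le herg).trans hostKraCenter_le_center), hdisc,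
    fun a ha b hb => hostKraLattice_comm ha hb,
    hostKraCenter φ R, isCompact_hostKraCenter, isRealLieGroup_hostKraCenter hK,
    hostKraCenter_le_center, commutator_hostKra_le herg, hostKraLattice_inf_center⟩, ?_⟩
  refine abstractlyIsomorphic_of_measurableEquiv (ρ.extension κ) A.system e
    (e.measurable.measurePreserving _) fun γ => ?_
  filter_upwards [Measure.quasiMeasurePreserving_fst.ae (hequiv γ)] with p ⟨a, ha, hp⟩
  change QuotientGroup.mk (s (φ γ + p.1) * hostKraConst φ R (p.2 + ρ.toFun γ p.1)) =
    (QuotientGroup.mk (hostKraHom hR (Multiplicative.ofAdd γ) *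
      (s p.1 * hostKraConst φ R p.2)) : hostKra φ R ⧸ L)
  rw [QuotientGroup.eq, ← mul_assoc (hostKraHom hR _), hp]
  have : (s (φ γ + p.1) * hostKraConst φ R (p.2 + ρ.toFun γ p.1))⁻¹ *
      (s (φ γ + p.1) * hostKraConst φ R (ρ.toFun γ p.1) * a * hostKraConst φ R p.2) = a := by
    rw [inv_mul_eq_iff_eq_mul, hostKraConst_add, hostKraConst_mul_comm p.2, mul_assoc, mul_assoc,
      ← hostKraConst_mul_comm p.2 a, mul_assoc, mul_assoc]
  rw [this]
  exact ha

end CLSystem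

theorem proposition4p3 {Γ : Type w} [AddCommGroup Γ] [Countable Γ]
    {Z : Type u} [AddCommGroup Z] [TopologicalSpace Z] [IsTopologicalAddGroup Z] [CompactSpace Z]
    [TopologicalSpace.MetrizableSpace Z] [MeasurableSpace Z] [BorelSpace Z]
    (μ : Measure Z) [μ.IsAddHaarMeasure] [IsProbabilityMeasure μ]
    (φ : Γ →+ Z) (hZ : (CLSystem.rotationSystem μ φ).IsErgodic)
    {K : Type v} [AddCommGroup K] [TopologicalSpace K] [IsTopologicalAddGroup K] [CompactSpace K]
    [T2Space K] [SecondCountableTopology K] [MeasurableSpace K] [BorelSpace K]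
    (hK : CLSystem.IsRealLieAddGroup K)
    (κ : Measure K) [κ.IsAddHaarMeasure] [IsProbabilityMeasure κ]
    (ρ : CLSystem.Cocycle (CLSystem.rotationSystem μ φ) K)
    (hρ : (ρ.extension κ).IsErgodic) (hCL : ρ.ConzeLesigne) :
    ∃ A : CLSystem.TranslationalSystem.{max u v, w} Γ,
      A.IsGood ∧ CLSystem.AbstractlyIsomorphic (ρ.extension κ) A.system := by
  let _ := CLSystem.normedAddCommGroupOfCompact Z
  let _ := CLSystem.normedAddCommGroupOfCompact K
  exact CLSystem.exists_isGood_abstractlyIsomorphic μ φ hZ hK κ ρ hCL
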